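/- Let $K$ be a field and let $(A,\Delta)$ be a regular multiplier Hopf algebra over $K$ (with non-degenerate, possibly non-unital product), with counit $\varepsilon$ and (bijective) antipode $S:A\to A$. Write $M(\cdot)$ for the multiplier algebra, $\iota$ for the identity map, $m$ for the multiplication map and $\tau$ for the flip of $A\otimes A$; homomorphisms and anti-homomorphisms such as $\Delta\otimes\iota$, $\varepsilon\otimes\iota$, $S$, $\tau$ are extended to multipliers, and $X_{21}=\tau(X)$ for $X\in M(A\otimes A)$. Suppose $(A,\Delta)$ is quasitriangular with generalized $R$-matrix $\mathcal R$, i.e. $\mathcal R\in M(A\otimes A)$ is invertible, $(\Delta\otimes\iota)(\mathcal R)=\mathcal R^{13}\mathcal R^{23}$, $(\iota\otimes\Delta)(\mathcal R)=\mathcal R^{13}\mathcal R^{12}$, $\mathcal R\,\Delta(a)=\tau(\Delta(a))\,\mathcal R$ for all $a\in A$, and $(\iota\otimes\varepsilon)(\mathcal R)=1=(\varepsilon\otimes\iota)(\mathcal R)$. Let $J\in M(A\otimes A)$ be a (normalized) twist, i.e. an invertible multiplier with $(\Delta\otimes\iota)(J)(J\otimes1)=(\iota\otimes\Delta)(J)(1\otimes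 J)$ and $(\varepsilon\otimes\iota)(J)=1=(\iota\otimes\varepsilon)(J)$, such that for $X=J$ and for $X=J^{-1}$ one has $X(1\otimes a),(1\otimes a)X\in M(A)\otimes A$ and $X(a\otimes1),(a\otimes1)X\in A\otimes M(A)$ for all $a\in A$. Then there is an invertible multiplier $Q_J=S(J^{(1)})J^{(2)}\in M(A)$, that is, $$b\,Q_J\,a=m(S\otimes\iota)\big(J(S^{-1}(b)\otimes a)\big)\qquad(a,b\in A).$$ Put $S^J(a)=Q_J^{-1}S(a)Q_J$ (a bijective anti-homomorphism $A\to A$, the antipode of the twisted multiplier Hopf algebra $A^J$ with $\Delta^J(a)=J^{-1}\Delta(a)J$) and $\mathcal R^J=J_{21}^{-1}\mathcal R J$. Then there is an invertible multiplier $\mu=S^J({\mathcal R^J}^{(2)})\,{\mathcal R^J}^{(1)}\in M(A)$, that is, $$b\,\mu\,a=m(S^J\otimes\iota)\,\tau\big(\mathcal R^J(a\otimes (S^J)^{-1}(b))\big)\qquad(a,b\in A),$$ and with $g=\mu\,S^J(\mu)^{-1}\in M(A)$ one has $$(S^J)^4(a)=g\,a\,g^{-1}\qquad\text{for all }a\in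 A.$$ -/

import Mathlib

open scoped TensorProduct

noncomputable section

/-- The product of the (possibly non-unital) algebra `A` is non-degenerate. -/
def NondegenerateMul (A : Type*) [NonUnitalRing A] : Prop :=
  (∀ a : A, (∀ b, a * b = 0) → a = 0) ∧ (∀ a : A, (∀ b, b * a = 0) → a = 0)

/-- The multiplier algebra `M(A)`: pairs `(L, R)` of linear maps of `A` ("left multiplication by
`m`" and "right multiplication by `m`") with `L (ab) = L(a) b`, `R (ab) = a R(b)` and
`a L(b) = R(a) b`. The product is `(L, R) (L', R') = (L ∘ L', R' ∘ R)`, the unit is `(id, id)`. -/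
def multiplierAlgebra (K A : Type*) [Field K] [NonUnitalRing A] [Module K A]
    [IsScalarTower K A A] [SMulCommClass K A A] :
    Subalgebra K (Module.End K A × (Module.End K A)ᵐᵒᵖ) where
  carrier := {p | (∀ a b, p.1 (a * b) = p.1 a * b) ∧
    (∀ a b, p.2.unop (a * b) = a * p.2.unop b) ∧ (∀ a b, a * p.1 b = p.2.unop a * b)}
  mul_mem' := by
    rintro p q ⟨h1, h2, h3⟩ ⟨k1, k2, k3⟩
    refine ⟨fun a b => ?_, fun a b => ?_, fun a b => ?_⟩
    · simp [h1, k1]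
    · simp [h2, k2]
    · simp [h3, k3]
  add_mem' := by
    rintro p q ⟨h1, h2, h3⟩ ⟨k1, k2, k3⟩
    refine ⟨fun a b => ?_, fun a b => ?_, fun a b => ?_⟩
    · simp [h1, k1, add_mul]
    · simp [h2, k2, mul_add]
    · simp [h3, k3, add_mul, mul_add]
  algebraMap_mem' := by
    intro r
    refine ⟨fun a b => ?_, fun a b => ?_, fun a b => ?_⟩
    · simp [Module.algebraMap_end_apply, smul_mul_assoc]
    · simp [Module.algebraMap_end_apply, mul_smul_comm, MulOpposite.algebraMap_apply]
    · simp [Module.algebraMap_end_apply, mul_smul_comm, smul_mul_assoc,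
        MulOpposite.algebraMap_apply]

/-- The type of multipliers of `A`, a unital `K`-algebra. -/
def Mult (K A : Type*) [Field K] [NonUnitalRing A] [Module K A]
    [IsScalarTower K A A] [SMulCommClass K A A] : Type _ := multiplierAlgebra K A

instance Mult.instRing (K A : Type*) [Field K] [NonUnitalRing A] [Module K A]
    [IsScalarTower K A A] [SMulCommClass K A A] : Ring (Mult K A) :=
  inferInstanceAs (Ring (multiplierAlgebra K A))

instance Mult.instAlgebra (K A : Type*) [Field K] [NonUnitalRing A] [Module K A]
    [IsScalarTower K A A] [SMulCommClass K A A] : Algebra K (Mult K A) :=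
  inferInstanceAs (Algebra K (multiplierAlgebra K A))

namespace Mult

variable {K A B : Type*} [Field K]
  [NonUnitalRing A] [Module K A] [IsScalarTower K A A] [SMulCommClass K A A]
  [NonUnitalRing B] [Module K B] [IsScalarTower K B B] [SMulCommClass K B B]

/-- Left multiplication `a ↦ m a` by a multiplier. -/
def left (m : Mult K A) : A →ₗ[K] A := m.1.1

/-- Right multiplication `a ↦ a m` by a multiplier. -/
def right (m : Mult K A) : A →ₗ[K] A := m.1.2.unop

/-- The multiplier with the given left and right multiplications. -/
def mk (L R : A →ₗ[K] A) (h1 : ∀ a b, L (a * b) = L a * b) (h2 : ∀ a b, R (a * b) = a * R b)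
    (h3 : ∀ a b, a * L b = R a * b) : Mult K A :=
  ⟨(L, MulOpposite.op R), h1, h2, h3⟩

@[ext] theorem ext {m n : Mult K A} (h1 : ∀ a, m.left a = n.left a)
    (h2 : ∀ a, m.right a = n.right a) : m = n :=
  Subtype.ext (Prod.ext (LinearMap.ext h1) (MulOpposite.unop_injective (LinearMap.ext h2)))

theorem left_mul_apply (m : Mult K A) (a b : A) : m.left (a * b) = m.left a * b := m.2.1 a b

theorem right_mul_apply (m : Mult K A) (a b : A) : m.right (a * b) = a * m.right b := m.2.2.1 a b

theorem mul_left_apply (m : Mult K A) (a b : A) : a * m.left b = m.right a * b := m.2.2.2 a b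

@[simp] theorem left_mk (L R : A →ₗ[K] A) (h1 h2 h3) : (mk L R h1 h2 h3).left = L := rfl

@[simp] theorem right_mk (L R : A →ₗ[K] A) (h1 h2 h3) : (mk L R h1 h2 h3).right = R := rfl

@[simp] theorem left_mul (m n : Mult K A) (a : A) : (m * n).left a = m.left (n.left a) := rfl

@[simp] theorem right_mul (m n : Mult K A) (a : A) : (m * n).right a = n.right (m.right a) := rfl

@[simp] theorem left_one (a : A) : (1 : Mult K A).left a = a := rfl

@[simp] theorem right_one (a : A) : (1 : Mult K A).right a = a := rfl

@[simp] theorem left_add (m n : Mult K A) (a : A) : (m + n).left a = m.left a + n.left a := rfl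

@[simp] theorem right_add (m n : Mult K A) (a : A) : (m + n).right a = m.right a + n.right a := rfl

@[simp] theorem left_smul (c : K) (m : Mult K A) (a : A) : (c • m).left a = c • m.left a := rfl

@[simp] theorem right_smul (c : K) (m : Mult K A) (a : A) : (c • m).right a = c • m.right a := rfl

/-- For a non-degenerate product, `m (a n) = (m a) n`. -/
theorem left_right_comm (hA : NondegenerateMul A) (m n : Mult K A) (a : A) :
    m.left (n.right a) = n.right (m.left a) := by
  rw [← sub_eq_zero]
  refine hA.2 _ fun b => ?_
  rw [mul_sub, mul_left_apply, ← right_mul_apply, ← right_mul_apply, mul_left_apply, sub_self]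

variable (K) in
/-- The canonical map `A → M(A)`; it is injective when the product of `A` is non-degenerate. -/
def of : A →ₗ[K] Mult K A where
  toFun a := mk (LinearMap.mulLeft K a) (LinearMap.mulRight K a)
    (fun b c => by simp [mul_assoc]) (fun b c => by simp [mul_assoc])
    (fun b c => by simp [mul_assoc])
  map_add' a b := Mult.ext (fun c => add_mul a b c) (fun c => mul_add c a b)
  map_smul' r a := Mult.ext (fun c => smul_mul_assoc r a c) (fun c => mul_smul_comm r c a)

@[simp] theorem left_of (a b : A) : (of K a).left b = a * b := rfl

@[simp] theorem right_of (a b : A) : (of K a).right b = b * a := rfl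

/-- The multiplier `m ⊗ n` of `A ⊗ B`, bilinear in `m ∈ M(A)` and `n ∈ M(B)`. -/
def tmul : Mult K A →ₗ[K] Mult K B →ₗ[K] Mult K (A ⊗[K] B) :=
  LinearMap.mk₂ K
    (fun m n => mk (TensorProduct.map m.left n.left) (TensorProduct.map m.right n.right)
      (fun x y => by
        induction x with
        | zero => simp
        | add x x' hx hx' => simp only [add_mul, map_add, hx, hx']
        | tmul a b =>
          induction y with
          | zero => simp
          | add y y' hy hy' => simp only [mul_add, map_add, hy, hy']
          | tmul c d => simp [left_mul_apply])
      (fun x y => by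
        induction x with
        | zero => simp
        | add x x' hx hx' => simp only [add_mul, map_add, hx, hx']
        | tmul a b =>
          induction y with
          | zero => simp
          | add y y' hy hy' => simp only [mul_add, map_add, hy, hy']
          | tmul c d => simp [right_mul_apply])
      (fun x y => by
        induction x with
        | zero => simp
        | add x x' hx hx' => simp only [add_mul, map_add, hx, hx']
        | tmul a b =>
          induction y with
          | zero => simp
          | add y y' hy hy' => simp only [mul_add, map_add, hy, hy']
          | tmul c d => simp [mul_left_apply]))
    (fun m m' n => by
      ext x
      · exact congrArg (fun f : A ⊗[K] B →ₗ[K] A ⊗[K] B => f x)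
          (TensorProduct.map_add_left m.left m'.left n.left)
      · exact congrArg (fun f : A ⊗[K] B →ₗ[K] A ⊗[K] B => f x)
          (TensorProduct.map_add_left m.right m'.right n.right))
    (fun c m n => by
      ext x
      · exact congrArg (fun f : A ⊗[K] B →ₗ[K] A ⊗[K] B => f x)
          (TensorProduct.map_smul_left c m.left n.left)
      · exact congrArg (fun f : A ⊗[K] B →ₗ[K] A ⊗[K] B => f x)
          (TensorProduct.map_smul_left c m.right n.right))
    (fun m n n' => by
      ext x
      · exact congrArg (fun f : A ⊗[K] B →ₗ[K] A ⊗[K] B => f x)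
          (TensorProduct.map_add_right m.left n.left n'.left)
      · exact congrArg (fun f : A ⊗[K] B →ₗ[K] A ⊗[K] B => f x)
          (TensorProduct.map_add_right m.right n.right n'.right))
    (fun c m n => by
      ext x
      · exact congrArg (fun f : A ⊗[K] B →ₗ[K] A ⊗[K] B => f x)
          (TensorProduct.map_smul_right c m.left n.left)
      · exact congrArg (fun f : A ⊗[K] B →ₗ[K] A ⊗[K] B => f x)
          (TensorProduct.map_smul_right c m.right n.right))

/-- Transport of multipliers along an isomorphism of algebras `e : A ≃ B`. -/
def congr (e : A ≃ₗ[K] B) (he : ∀ x y, e (x * y) = e x * e y) (m : Mult K A) : Mult K B :=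
  have he' : ∀ x y, e.symm (x * y) = e.symm x * e.symm y := fun x y => by
    apply e.injective
    simp [he]
  mk (e.toLinearMap ∘ₗ m.left ∘ₗ e.symm.toLinearMap) (e.toLinearMap ∘ₗ m.right ∘ₗ e.symm.toLinearMap)
    (fun a b => by simp [he', he, left_mul_apply])
    (fun a b => by simp [he', he, right_mul_apply])
    (fun a b => by
      have := congrArg e (mul_left_apply m (e.symm a) (e.symm b))
      simpa [he] using this)

/-- `X ∈ M(B)` is the value at `m ∈ M(A)` of the extension to multipliers of a homomorphism
`f : A → M(B)`: `X f(a) = f(m a)` and `f(a) X = f(a m)` for all `a ∈ A`. For a non-degenerate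
homomorphism `f` (that is, `f(A) B = B = B f(A)`), there is exactly one such `X` for each `m`. -/
def IsExtension (f : A →ₗ[K] Mult K B) (m : Mult K A) (X : Mult K B) : Prop :=
  ∀ a : A, X * f a = f (m.left a) ∧ f a * X = f (m.right a)

end Mult

section Flips

variable {K A : Type*} [Field K]
  [NonUnitalRing A] [Module K A] [IsScalarTower K A A] [SMulCommClass K A A]

theorem tensor_comm_mul (x y : A ⊗[K] A) : TensorProduct.comm K A A (x * y) =
    TensorProduct.comm K A A x * TensorProduct.comm K A A y := by
  induction x with
  | zero => simp
  | add x x' hx hx' => simp only [add_mul, map_add, hx, hx']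
  | tmul a b =>
    induction y with
    | zero => simp
    | add y y' hy hy' => simp only [mul_add, map_add, hy, hy']
    | tmul c d => simp

theorem tensor_assoc_mul (x y : (A ⊗[K] A) ⊗[K] A) : TensorProduct.assoc K A A A (x * y) =
    TensorProduct.assoc K A A A x * TensorProduct.assoc K A A A y := by
  induction x with
  | zero => simp
  | add x x' hx hx' => simp only [add_mul, map_add, hx, hx']
  | tmul a b =>
    induction y with
    | zero => simp
    | add y y' hy hy' => simp only [mul_add, map_add, hy, hy']
    | tmul c d =>
      induction a with
      | zero => simp
      | add a a' ha ha' => simp only [TensorProduct.add_tmul, add_mul, map_add, ha, ha']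
      | tmul a a' =>
        induction c with
        | zero => simp
        | add c c' hc hc' => simp only [TensorProduct.add_tmul, mul_add, map_add, hc, hc']
        | tmul c c' => simp

theorem tensor_swap23_mul (x y : A ⊗[K] (A ⊗[K] A)) :
    (TensorProduct.comm K A A).lTensor A (x * y) =
      (TensorProduct.comm K A A).lTensor A x * (TensorProduct.comm K A A).lTensor A y := by
  induction x with
  | zero => simp
  | add x x' hx hx' => simp only [add_mul, map_add, hx, hx']
  | tmul a b =>
    induction y with
    | zero => simp
    | add y y' hy hy' => simp only [mul_add, map_add, hy, hy']
    | tmul c d => simp [tensor_comm_mul]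

/-- The identification `M((A ⊗ A) ⊗ A) → M(A ⊗ (A ⊗ A))`. -/
def Mult.assoc (X : Mult K ((A ⊗[K] A) ⊗[K] A)) : Mult K (A ⊗[K] (A ⊗[K] A)) :=
  X.congr (TensorProduct.assoc K A A A) tensor_assoc_mul

/-- `Mult.assoc` as a linear map. -/
def Mult.assocLinear :
    Mult K ((A ⊗[K] A) ⊗[K] A) →ₗ[K] Mult K (A ⊗[K] (A ⊗[K] A)) where
  toFun := Mult.assoc
  map_add' X Y := by ext x <;> simp [Mult.assoc, Mult.congr]
  map_smul' c X := by ext x <;> simp [Mult.assoc, Mult.congr]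

/-- `X₂₁ = τ(X)`, with `τ` the flip of `A ⊗ A`, extended to `M(A ⊗ A)`. -/
def Mult.flip (X : Mult K (A ⊗[K] A)) : Mult K (A ⊗[K] A) :=
  X.congr (TensorProduct.comm K A A) tensor_comm_mul

/-- `X¹² = X ⊗ 1` in `M(A ⊗ A ⊗ A)`. -/
def Mult.leg12 (X : Mult K (A ⊗[K] A)) : Mult K (A ⊗[K] (A ⊗[K] A)) :=
  (Mult.tmul X 1).assoc

/-- `X²³ = 1 ⊗ X` in `M(A ⊗ A ⊗ A)`. -/
def Mult.leg23 (X : Mult K (A ⊗[K] A)) : Mult K (A ⊗[K] (A ⊗[K] A)) :=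
  Mult.tmul 1 X

/-- `X¹³` in `M(A ⊗ A ⊗ A)`: `X ⊗ 1` with the last two legs exchanged. -/
def Mult.leg13 (X : Mult K (A ⊗[K] A)) : Mult K (A ⊗[K] (A ⊗[K] A)) :=
  X.leg12.congr ((TensorProduct.comm K A A).lTensor A) tensor_swap23_mul

end Flips

section AntiAut

/-- A bijective linear anti-homomorphism `A → A`. -/
structure AntiAut (K A : Type*) [Field K] [NonUnitalRing A] [Module K A] extends A ≃ₗ[K] A where
  map_mul' : ∀ a b, toFun (a * b) = toFun b * toFun a

theorem AntiAut.map_mul {K A : Type*} [Field K] [NonUnitalRing A] [Module K A]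
    (S : AntiAut K A) (a b : A) :
    S.toLinearEquiv (a * b) = S.toLinearEquiv b * S.toLinearEquiv a := S.map_mul' a b

variable {K A : Type*} [Field K]
  [NonUnitalRing A] [Module K A] [IsScalarTower K A A] [SMulCommClass K A A]

namespace AntiAut

theorem symm_map_mul (S : AntiAut K A) (a b : A) :
    S.toLinearEquiv.symm (a * b) = S.toLinearEquiv.symm b * S.toLinearEquiv.symm a := by
  apply S.toLinearEquiv.injective
  simp [map_mul]

/-- The extension of `S` to the multiplier algebra: `S(m) S(a) = S(a m)`, `S(a) S(m) = S(m a)`. -/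
def extend (S : AntiAut K A) (m : Mult K A) : Mult K A :=
  Mult.mk (S.toLinearEquiv.toLinearMap ∘ₗ m.right ∘ₗ S.toLinearEquiv.symm.toLinearMap)
    (S.toLinearEquiv.toLinearMap ∘ₗ m.left ∘ₗ S.toLinearEquiv.symm.toLinearMap)
    (fun a b => by simp [symm_map_mul, map_mul, Mult.right_mul_apply])
    (fun a b => by simp [symm_map_mul, map_mul, Mult.left_mul_apply])
    (fun a b => by
      have := congrArg S.toLinearEquiv
        (Mult.mul_left_apply m (S.toLinearEquiv.symm b) (S.toLinearEquiv.symm a))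
      simpa [map_mul] using this.symm)

/-- The extension of `S` on invertible multipliers. -/
def extendUnits (S : AntiAut K A) (u : (Mult K A)ˣ) : (Mult K A)ˣ where
  val := S.extend u
  inv := S.extend (u⁻¹ : (Mult K A)ˣ)
  val_inv := by
    ext a
    · simp [extend, ← Mult.right_mul]
    · simp [extend, ← Mult.left_mul]
  inv_val := by
    ext a
    · simp [extend, ← Mult.right_mul]
    · simp [extend, ← Mult.left_mul]

/-- `a ↦ Q⁻¹ S(a) Q`, for an invertible multiplier `Q`. -/
def conj (S : AntiAut K A) (hA : NondegenerateMul A) (Q : (Mult K A)ˣ) : AntiAut K A where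
  toFun a := (Q⁻¹ : (Mult K A)ˣ).val.left (Q.val.right (S.toLinearEquiv a))
  invFun a := S.toLinearEquiv.symm (Q.val.left ((Q⁻¹ : (Mult K A)ˣ).val.right a))
  map_add' a b := by simp
  map_smul' c a := by simp
  left_inv a := by
    beta_reduce
    rw [← Mult.left_right_comm hA, ← Mult.left_mul, ← Mult.right_mul]
    simp
  right_inv a := by
    beta_reduce
    rw [LinearEquiv.apply_symm_apply, ← Mult.left_right_comm hA, ← Mult.left_mul, ← Mult.right_mul]
    simp
  map_mul' a b := by
    rw [S.map_mul, ← Mult.left_mul_apply, ← Mult.mul_left_apply, ← Mult.left_mul Q.val,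
      Units.mul_inv, Mult.left_one, Mult.right_mul_apply]

end AntiAut

end AntiAut

section MultiplierHopf

variable (K A : Type*) [Field K]
  [NonUnitalRing A] [Module K A] [IsScalarTower K A A] [SMulCommClass K A A]

variable {K A} in
/-- `Δ ⊗ ι : A ⊗ A → M(A ⊗ A ⊗ A)`, for a linear map `Δ : A → M(A ⊗ A)`. -/
def deltaTensorId (Δ : A →ₗ[K] Mult K (A ⊗[K] A)) :
    A ⊗[K] A →ₗ[K] Mult K (A ⊗[K] (A ⊗[K] A)) :=
  Mult.assocLinear ∘ₗ TensorProduct.lift (Mult.tmul.compl₁₂ Δ (Mult.of K))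

variable {K A} in
/-- `ι ⊗ Δ : A ⊗ A → M(A ⊗ A ⊗ A)`, for a linear map `Δ : A → M(A ⊗ A)`. -/
def idTensorDelta (Δ : A →ₗ[K] Mult K (A ⊗[K] A)) :
    A ⊗[K] A →ₗ[K] Mult K (A ⊗[K] (A ⊗[K] A)) :=
  TensorProduct.lift (Mult.tmul.compl₁₂ (Mult.of K) Δ)

/-- A regular multiplier Hopf algebra: an algebra `A` with non-degenerate product and a
coassociative homomorphism `Δ : A → M(A ⊗ A)` such that `a ⊗ b ↦ Δ(a)(1 ⊗ b)` and
`a ⊗ b ↦ (a ⊗ 1)Δ(b)` are bijections of `A ⊗ A` onto `A ⊗ A`, and likewise for the co-opposite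
`τ ∘ Δ`, that is, `a ⊗ b ↦ Δ(a)(b ⊗ 1)` and `a ⊗ b ↦ (1 ⊗ a)Δ(b)` are bijections of `A ⊗ A` onto
`A ⊗ A`. The four bijections `T₁, …, T₄` are determined by `Δ`. -/
structure RegularMultiplierHopfAlgebra where
  nondegenerate : NondegenerateMul A
  /-- The comultiplication. -/
  Δ : A →ₗ[K] Mult K (A ⊗[K] A)
  Δ_mul : ∀ a b, Δ (a * b) = Δ a * Δ b
  T₁ : (A ⊗[K] A) ≃ₗ[K] (A ⊗[K] A)
  T₂ : (A ⊗[K] A) ≃ₗ[K] (A ⊗[K] A)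
  T₃ : (A ⊗[K] A) ≃ₗ[K] (A ⊗[K] A)
  T₄ : (A ⊗[K] A) ≃ₗ[K] (A ⊗[K] A)
  T₁_spec : ∀ a b, Mult.of K (T₁ (a ⊗ₜ b)) = Δ a * Mult.tmul 1 (Mult.of K b)
  T₂_spec : ∀ a b, Mult.of K (T₂ (a ⊗ₜ b)) = Mult.tmul (Mult.of K a) 1 * Δ b
  T₃_spec : ∀ a b, Mult.of K (T₃ (a ⊗ₜ b)) = Δ a * Mult.tmul (Mult.of K b) 1
  T₄_spec : ∀ a b, Mult.of K (T₄ (a ⊗ₜ b)) = Mult.tmul 1 (Mult.of K a) * Δ b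
  /-- `(a ⊗ 1 ⊗ 1)(Δ ⊗ ι)(Δ(b)(1 ⊗ c)) = (ι ⊗ Δ)((a ⊗ 1)Δ(b))(1 ⊗ 1 ⊗ c)` -/
  coassoc : ∀ a b c : A,
    Mult.tmul (Mult.of K a) 1 * deltaTensorId Δ (T₁ (b ⊗ₜ c)) =
      idTensorDelta Δ (T₂ (a ⊗ₜ b)) *
        Mult.tmul 1 (Mult.tmul 1 (Mult.of K c))

namespace RegularMultiplierHopfAlgebra

variable {K A} (H : RegularMultiplierHopfAlgebra K A)

/-- `Δ ⊗ ι : A ⊗ A → M(A ⊗ A ⊗ A)`. -/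
def comulLeft : A ⊗[K] A →ₗ[K] Mult K (A ⊗[K] (A ⊗[K] A)) :=
  deltaTensorId H.Δ

/-- `ι ⊗ Δ : A ⊗ A → M(A ⊗ A ⊗ A)`. -/
def comulRight : A ⊗[K] A →ₗ[K] Mult K (A ⊗[K] (A ⊗[K] A)) :=
  idTensorDelta H.Δ

/-- `ε ⊗ ι : A ⊗ A → A`. -/
def counitLeft (ε : A →ₙₐ[K] K) : A ⊗[K] A →ₗ[K] A :=
  (TensorProduct.lid K A).toLinearMap ∘ₗ TensorProduct.map (ε : A →ₗ[K] K) LinearMap.id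

/-- `ι ⊗ ε : A ⊗ A → A`. -/
def counitRight (ε : A →ₙₐ[K] K) : A ⊗[K] A →ₗ[K] A :=
  (TensorProduct.rid K A).toLinearMap ∘ₗ TensorProduct.map LinearMap.id (ε : A →ₗ[K] K)

/-- The homomorphism `ε : A → K` is the counit: `(ε ⊗ ι)(Δ(a)(1 ⊗ b)) = ab` and
`(ι ⊗ ε)((a ⊗ 1)Δ(b)) = ab`. -/
def IsCounit (ε : A →ₙₐ[K] K) : Prop :=
  (∀ a b, counitLeft ε (H.T₁ (a ⊗ₜ b)) = a * b) ∧ (∀ a b, counitRight ε (H.T₂ (a ⊗ₜ b)) = a * b)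

/-- The bijective anti-homomorphism `S : A → A` is the antipode: `m(S ⊗ ι)(Δ(a)(1 ⊗ b)) = ε(a) b`
and `m(ι ⊗ S)((a ⊗ 1)Δ(b)) = ε(b) a`. -/
def IsAntipode (ε : A →ₙₐ[K] K) (S : AntiAut K A) : Prop :=
  (∀ a b, LinearMap.mul' K A
    (TensorProduct.map S.toLinearEquiv.toLinearMap LinearMap.id (H.T₁ (a ⊗ₜ b))) = ε a • b) ∧
  (∀ a b, LinearMap.mul' K A
    (TensorProduct.map LinearMap.id S.toLinearEquiv.toLinearMap (H.T₂ (a ⊗ₜ b))) = ε b • a)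

/-- `(ε ⊗ ι)(X) = 1 = (ι ⊗ ε)(X)` in `M(A)`, for `X ∈ M(A ⊗ A)`. -/
def IsNormalized (ε : A →ₙₐ[K] K) (X : Mult K (A ⊗[K] A)) : Prop :=
  Mult.IsExtension (Mult.of K ∘ₗ counitLeft ε) X 1 ∧
    Mult.IsExtension (Mult.of K ∘ₗ counitRight ε) X 1

/-- `R` is a quasitriangular structure (generalized `R`-matrix) for `(A, Δ)`:
`(Δ ⊗ ι)(R) = R¹³ R²³`, `(ι ⊗ Δ)(R) = R¹³ R¹²`, `R Δ(a) = Δᶜᵒᵖ(a) R` for all `a`, and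
`(ι ⊗ ε)(R) = 1 = (ε ⊗ ι)(R)`. -/
structure IsQuasitriangular (ε : A →ₙₐ[K] K) (R : (Mult K (A ⊗[K] A))ˣ) : Prop where
  comul_left : Mult.IsExtension H.comulLeft R.val (R.val.leg13 * R.val.leg23)
  comul_right : Mult.IsExtension H.comulRight R.val (R.val.leg13 * R.val.leg12)
  comm : ∀ a, R.val * H.Δ a = (H.Δ a).flip * R.val
  counit : IsNormalized ε R.val

/-- `J` is a (normalized) twist: `(Δ ⊗ ι)(J)(J ⊗ 1) = (ι ⊗ Δ)(J)(1 ⊗ J)`, where `X = (Δ ⊗ ι)(J)`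
and `Y = (ι ⊗ Δ)(J)`, and `(ε ⊗ ι)(J) = 1 = (ι ⊗ ε)(J)`. -/
structure IsTwist (ε : A →ₙₐ[K] K) (J : (Mult K (A ⊗[K] A))ˣ) : Prop where
  cocycle : ∃ X Y, Mult.IsExtension H.comulLeft J.val X ∧ Mult.IsExtension H.comulRight J.val Y ∧
    X * J.val.leg12 = Y * J.val.leg23
  counit : IsNormalized ε J.val

end RegularMultiplierHopfAlgebra

variable {K A}

/-- The subspace `M(A) ⊗ A` of `M(A ⊗ A)`. -/
def multTensor : Submodule K (Mult K (A ⊗[K] A)) :=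
  Submodule.span K {X | ∃ (m : Mult K A) (a : A), X = Mult.tmul m (Mult.of K a)}

/-- The subspace `A ⊗ M(A)` of `M(A ⊗ A)`. -/
def tensorMult : Submodule K (Mult K (A ⊗[K] A)) :=
  Submodule.span K {X | ∃ (a : A) (m : Mult K A), X = Mult.tmul (Mult.of K a) m}

/-- `X(1 ⊗ a), (1 ⊗ a)X ∈ M(A) ⊗ A` and `X(a ⊗ 1), (a ⊗ 1)X ∈ A ⊗ M(A)` for all `a ∈ A`. -/
def IsCovered (X : Mult K (A ⊗[K] A)) : Prop :=
  ∀ a : A, X * Mult.tmul 1 (Mult.of K a) ∈ multTensor (K := K) (A := A) ∧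
    Mult.tmul 1 (Mult.of K a) * X ∈ multTensor (K := K) (A := A) ∧
    X * Mult.tmul (Mult.of K a) 1 ∈ tensorMult (K := K) (A := A) ∧
    Mult.tmul (Mult.of K a) 1 * X ∈ tensorMult (K := K) (A := A)

/-- `Q = S(X⁽¹⁾) X⁽²⁾` for a multiplier `X` of `A ⊗ A`:
`b (Q a) = b S(X⁽¹⁾) X⁽²⁾ a = m(S ⊗ ι)(X (S⁻¹(b) ⊗ a))` for all `a, b ∈ A`.
By non-degeneracy there is at most one such `Q ∈ M(A)`. -/
def IsAntipodeFst (S : AntiAut K A) (X : Mult K (A ⊗[K] A)) (Q : Mult K A) : Prop :=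
  ∀ a b : A, b * Q.left a = LinearMap.mul' K A
    (TensorProduct.map S.toLinearEquiv.toLinearMap LinearMap.id
      (X.left (S.toLinearEquiv.symm b ⊗ₜ a)))

/-- `μ = S(X⁽²⁾) X⁽¹⁾` for a multiplier `X` of `A ⊗ A`:
`b (μ a) = b S(X⁽²⁾) X⁽¹⁾ a = m(S ⊗ ι)τ(X (a ⊗ S⁻¹(b)))` for all `a, b ∈ A`.
By non-degeneracy there is at most one such `μ ∈ M(A)`. -/
def IsAntipodeSnd (S : AntiAut K A) (X : Mult K (A ⊗[K] A)) (μ : Mult K A) : Prop :=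
  ∀ a b : A, b * μ.left a = LinearMap.mul' K A
    (TensorProduct.map S.toLinearEquiv.toLinearMap LinearMap.id
      (TensorProduct.comm K A A (X.left (a ⊗ₜ S.toLinearEquiv.symm b))))

/-- The twisted `R`-matrix `R^J = J₂₁⁻¹ R J`. -/
def twistedR (R J : (Mult K (A ⊗[K] A))ˣ) : Mult K (A ⊗[K] A) :=
  (J⁻¹ : (Mult K (A ⊗[K] A))ˣ).val.flip * R.val * J.val

end MultiplierHopf

end

/-! For a Hopf algebra with an R-matrix, Drinfeld's element u = S(R⁽²⁾)R⁽¹⁾ satisfies u c = S²(c) u.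
Applying S gives a S(u) = S(u) S²(a), so S² is implemented both by u and by S(u)⁻¹, and S⁴ is
conjugation by u S(u)⁻¹ (`AntiAut.iterate_four_eq_conj`). The theorem is this argument carried out
for A^J with S^J and R^J.

What the argument needs from an antipode is isolated in `IsAntipodeFor`: the contraction S(x)y
absorbs D(a) up to ε(a), and every map with that invariance exchanges c ⊗ 1 with 1 ⊗ S(c). From this
and R D(a) = D(a)₂₁ R follow the existence of u and the relation u c = S²(c) u; the same
construction for R⁻¹ and S⁻¹ gives its inverse (`exists_unit_drinfeld`). That S^J has the two
properties for Δ^J (`isAntipodeFor_conj`) reduces to S and Δ, through S(x) Q y = m(S ⊗ ι)(J(x ⊗ y)),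
once Q is invertible.

The covering conditions produce Q and the candidate inverse P = X⁽¹⁾S(X⁽²⁾) with X = J⁻¹.
Contracting two adjacent legs of the cocycle identity, and then the remaining two, gives QP = 1 and
PQ = 1. In the absence of a unit, a multiplier M is constructed and compared through the bilinear
map (b, a) ↦ b M a. -/

noncomputable section

/-! ### Non-degeneracy of A ⊗ A and the construction of multipliers. -/

section Nondegenerate

variable {K A : Type*} [Field K]
  [NonUnitalRing A] [Module K A] [IsScalarTower K A A] [SMulCommClass K A A]

theorem eq_zero_of_forall_functional_left {K V W : Type*} [Field K] [AddCommGroup V] [Module K V]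
    [AddCommGroup W] [Module K W] (z : V ⊗[K] W)
    (h : ∀ f : V →ₗ[K] K, TensorProduct.lid K W (TensorProduct.map f LinearMap.id z) = 0) :
    z = 0 := by
  classical
  let b := Module.Basis.ofVectorSpace K V
  apply (TensorProduct.equivFinsuppOfBasisLeft (N := W) b).injective
  ext i
  rw [map_zero, Finsupp.zero_apply, ← h (b.coord i)]
  clear h
  induction z with
  | zero => simp
  | add x y hx hy => simp only [map_add, Finsupp.add_apply, hx, hy]
  | tmul x y => simp

theorem eq_zero_of_forall_functional_right {K V W : Type*} [Field K] [AddCommGroup V] [Module K V]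
    [AddCommGroup W] [Module K W] (z : V ⊗[K] W)
    (h : ∀ f : W →ₗ[K] K, TensorProduct.rid K V (TensorProduct.map LinearMap.id f z) = 0) :
    z = 0 := by
  apply (TensorProduct.comm K V W).injective
  rw [map_zero]
  refine eq_zero_of_forall_functional_left _ fun f => ?_
  rw [← h f]
  clear h
  induction z with
  | zero => simp
  | add x y hx hy => simp only [map_add, hx, hy]
  | tmul x y => simp

/-- Functionals on one leg separate a tensor product over a field, so slicing one leg at a time
reduces the claim to the non-degeneracy of A. -/
theorem nondegenerateMul_tensor (hA : NondegenerateMul A) : NondegenerateMul (A ⊗[K] A) := by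
  constructor
  · intro z hz
    refine eq_zero_of_forall_functional_left z fun f => hA.1 _ fun d => ?_
    have key : TensorProduct.map LinearMap.id (LinearMap.mulRight K d) z = 0 := by
      refine eq_zero_of_forall_functional_right _ fun f => hA.1 _ fun c => ?_
      have := congrArg (fun t => TensorProduct.rid K A (TensorProduct.map LinearMap.id f t))
        (hz (c ⊗ₜ d))
      simp only [map_zero] at this
      rw [← this]
      clear this hz
      induction z with
      | zero => simp
      | add x y hx hy => simp only [map_add, add_mul, hx, hy]
      | tmul x y => simp [smul_mul_assoc]
    have := congrArg (fun t => TensorProduct.lid K A (TensorProduct.map f LinearMap.id t)) key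
    simp only [map_zero] at this
    rw [← this]
    clear this key hz
    induction z with
    | zero => simp
    | add x y hx hy => simp only [map_add, add_mul, hx, hy]
    | tmul x y => simp [smul_mul_assoc]
  · intro z hz
    refine eq_zero_of_forall_functional_left z fun f => hA.2 _ fun d => ?_
    have key : TensorProduct.map LinearMap.id (LinearMap.mulLeft K d) z = 0 := by
      refine eq_zero_of_forall_functional_right _ fun f => hA.2 _ fun c => ?_
      have := congrArg (fun t => TensorProduct.rid K A (TensorProduct.map LinearMap.id f t))
        (hz (c ⊗ₜ d))
      simp only [map_zero] at this
      rw [← this]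
      clear this hz
      induction z with
      | zero => simp
      | add x y hx hy => simp only [map_add, mul_add, hx, hy]
      | tmul x y => simp [mul_smul_comm]
    have := congrArg (fun t => TensorProduct.lid K A (TensorProduct.map f LinearMap.id t)) key
    simp only [map_zero] at this
    rw [← this]
    clear this key hz
    induction z with
    | zero => simp
    | add x y hx hy => simp only [map_add, mul_add, hx, hy]
    | tmul x y => simp [mul_smul_comm]

namespace NondegenerateMul

theorem left_cancel (hA : NondegenerateMul A) {x y : A} (h : ∀ b, b * x = b * y) : x = y :=
  sub_eq_zero.1 (hA.2 _ fun b => by rw [mul_sub, h, sub_self])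

theorem right_cancel (hA : NondegenerateMul A) {x y : A} (h : ∀ b, x * b = y * b) : x = y :=
  sub_eq_zero.1 (hA.1 _ fun b => by rw [sub_mul, h, sub_self])

/-- A multiplier is determined by its left multiplication. -/
theorem mult_ext_left (hA : NondegenerateMul A) {m n : Mult K A} (h : ∀ a, m.left a = n.left a) :
    m = n :=
  Mult.ext h fun a => hA.right_cancel fun b => by
    rw [← Mult.mul_left_apply, h, Mult.mul_left_apply]

/-- A multiplier from a bilinear map `U(b, a) = b M a`. -/
theorem exists_mult (hA : NondegenerateMul A) (U : A →ₗ[K] A →ₗ[K] A)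
    (hx : ∀ a, ∃ x, ∀ b, U b a = b * x) (hy : ∀ b, ∃ y, ∀ a, U b a = y * a) :
    ∃ M : Mult K A, ∀ a b, b * M.left a = U b a := by
  choose L hL using hx
  choose R hR using hy
  -- The values of `L` and `R` are unique by non-degeneracy, so linearity and the multiplier
  -- identities can be tested after multiplying by an element, where both sides become values of
  -- `U`.
  refine ⟨Mult.mk ⟨⟨L, fun a a' => hA.left_cancel fun b => ?_⟩,
    fun c a => hA.left_cancel fun b => ?_⟩ ⟨⟨R, fun a a' => hA.right_cancel fun b => ?_⟩,
    fun c a => hA.right_cancel fun b => ?_⟩ (fun a a' => hA.left_cancel fun b => ?_)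
    (fun a a' => hA.right_cancel fun b => ?_) (fun a b => ?_), fun a b => ?_⟩
  · rw [← hL, map_add, hL, hL, mul_add]
  · simp [← hL, mul_smul_comm]
  · rw [← hR, map_add, LinearMap.add_apply, hR, hR, add_mul]
  · simp [← hR, smul_mul_assoc]
  · change b * L (a * a') = b * (L a * a')
    rw [← hL, hR, ← mul_assoc, ← hR, hL, mul_assoc]
  · change R (a * a') * b = a * R a' * b
    rw [← hR, hL, mul_assoc, ← hL, hR, mul_assoc]
  · change a * L b = R a * b
    rw [← hL, hR]
  · exact (hL a b).symm

end NondegenerateMul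

end Nondegenerate

/-! ### Rules of computation for multipliers. -/

namespace Mult

variable {K A : Type*} [Field K]
  [NonUnitalRing A] [Module K A] [IsScalarTower K A A] [SMulCommClass K A A]

@[simp] theorem left_tmul {B : Type*} [NonUnitalRing B] [Module K B] [IsScalarTower K B B]
    [SMulCommClass K B B] (m : Mult K A) (n : Mult K B) (a : A) (b : B) :
    (tmul m n).left (a ⊗ₜ[K] b) = m.left a ⊗ₜ n.left b := rfl

@[simp] theorem right_tmul {B : Type*} [NonUnitalRing B] [Module K B] [IsScalarTower K B B]
    [SMulCommClass K B B] (m : Mult K A) (n : Mult K B) (a : A) (b : B) :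
    (tmul m n).right (a ⊗ₜ[K] b) = m.right a ⊗ₜ n.right b := rfl

@[simp] theorem left_flip (X : Mult K (A ⊗[K] A)) (w : A ⊗[K] A) :
    X.flip.left w = TensorProduct.comm K A A (X.left (TensorProduct.comm K A A w)) := rfl

theorem flip_mul (X Y : Mult K (A ⊗[K] A)) : (X * Y).flip = X.flip * Y.flip := by
  ext w <;> simp [flip, congr]

theorem flip_one : (1 : Mult K (A ⊗[K] A)).flip = 1 := by
  ext w <;> simp [flip, congr]

theorem flip_flip (X : Mult K (A ⊗[K] A)) : X.flip.flip = X := by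
  ext w <;> simp [flip, congr]

theorem of_injective (hA : NondegenerateMul A) : Function.Injective (of K : A → Mult K A) :=
  fun x y h => hA.right_cancel fun b => by rw [← left_of (K := K), h, left_of]

theorem mul_of (m : Mult K A) (a : A) : m * of K a = of K (m.left a) := by
  ext c
  · simp [left_mul_apply]
  · simp [mul_left_apply]

@[simp] theorem left_zero : (0 : Mult K A).left = 0 := rfl
@[simp] theorem right_zero : (0 : Mult K A).right = 0 := rfl

end Mult

/-! ### The contractions S(x)y and xS(y); algebras spanned by products. -/

section Contraction

variable {K A : Type*} [Field K]
  [NonUnitalRing A] [Module K A] [IsScalarTower K A A] [SMulCommClass K A A]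

namespace AntiAut

/-- `x ⊗ y ↦ S(x) y`. -/
def contractLeft (S : AntiAut K A) : A ⊗[K] A →ₗ[K] A :=
  LinearMap.mul' K A ∘ₗ TensorProduct.map S.toLinearEquiv.toLinearMap LinearMap.id

/-- `x ⊗ y ↦ x S(y)`. -/
def contractRight (S : AntiAut K A) : A ⊗[K] A →ₗ[K] A :=
  LinearMap.mul' K A ∘ₗ TensorProduct.map LinearMap.id S.toLinearEquiv.toLinearMap

@[simp] theorem contractLeft_tmul (S : AntiAut K A) (x y : A) :
    S.contractLeft (x ⊗ₜ y) = S.toLinearEquiv x * y := rfl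

@[simp] theorem contractRight_tmul (S : AntiAut K A) (x y : A) :
    S.contractRight (x ⊗ₜ y) = x * S.toLinearEquiv y := rfl

theorem contractLeft_mul_tmul (S : AntiAut K A) (z : A ⊗[K] A) (x y : A) :
    S.contractLeft (z * x ⊗ₜ y) = S.toLinearEquiv x * S.contractLeft z * y := by
  induction z with
  | zero => simp
  | add z z' h h' => simp only [add_mul, mul_add, map_add, h, h']
  | tmul a b => simp [S.map_mul, mul_assoc]

theorem contractRight_tmul_mul (S : AntiAut K A) (z : A ⊗[K] A) (x y : A) :
    S.contractRight (x ⊗ₜ y * z) = x * S.contractRight z * S.toLinearEquiv y := by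
  induction z with
  | zero => simp
  | add z z' h h' => simp only [add_mul, mul_add, map_add, h, h']
  | tmul a b => simp [S.map_mul, mul_assoc]

theorem apply_left (S : AntiAut K A) (m : Mult K A) (a : A) :
    S.toLinearEquiv (m.left a) = (S.extend m).right (S.toLinearEquiv a) := by
  simp [extend]

theorem apply_right (S : AntiAut K A) (m : Mult K A) (a : A) :
    S.toLinearEquiv (m.right a) = (S.extend m).left (S.toLinearEquiv a) := by
  simp [extend]

/-- The inverse of a bijective anti-homomorphism. -/
def symm (S : AntiAut K A) : AntiAut K A where
  toLinearEquiv := S.toLinearEquiv.symm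
  map_mul' := S.symm_map_mul

@[simp] theorem toLinearEquiv_symm (S : AntiAut K A) :
    S.symm.toLinearEquiv = S.toLinearEquiv.symm := rfl

end AntiAut

/-- Every element of `A` is a sum of products. -/
def IsIdempotentAlg (A : Type*) [NonUnitalRing A] : Prop :=
  AddSubmonoid.closure {x : A | ∃ a b, x = a * b} = ⊤

namespace IsIdempotentAlg

theorem induction {A : Type*} [NonUnitalRing A] (h : IsIdempotentAlg A) {p : A → Prop}
    (hmul : ∀ a b, p (a * b)) (hadd : ∀ a b, p a → p b → p (a + b)) (a : A) : p a := by
  have ha : a ∈ AddSubmonoid.closure {x : A | ∃ a b, x = a * b} := by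
    rw [IsIdempotentAlg] at h
    rw [h]
    trivial
  induction ha using AddSubmonoid.closure_induction with
  | mem x hx =>
    obtain ⟨a, b, rfl⟩ := hx
    exact hmul a b
  | zero => simpa using hmul 0 0
  | add x y _ _ hx hy => exact hadd x y hx hy

/-- Used to split off from a tensor a factor that covers Δ(a), so that Δ(a)(1 ⊗ b) or (b ⊗ 1)Δ(a) is
an element of A ⊗ A. -/
theorem tensor_induction (h : IsIdempotentAlg A) {p : A ⊗[K] A → Prop}
    (hmul : ∀ a b c d : A, p (a ⊗ₜ b * c ⊗ₜ d)) (hadd : ∀ a b, p a → p b → p (a + b))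
    (z : A ⊗[K] A) : p z := by
  induction z with
  | zero => simpa using hmul 0 0 0 0
  | add x y hx hy => exact hadd x y hx hy
  | tmul x y =>
    refine h.induction (p := fun x => p (x ⊗ₜ y)) (fun a c => ?_) (fun a b ha hb => ?_) x
    · refine h.induction (p := fun y => p ((a * c) ⊗ₜ y)) (fun b d => ?_) (fun b d hb hd => ?_) y
      · simpa using hmul a b c d
      · rw [TensorProduct.tmul_add]
        exact hadd _ _ hb hd
    · rw [TensorProduct.add_tmul]
      exact hadd _ _ ha hb

end IsIdempotentAlg

end Contraction

/-! ### Drinfeld's element for an abstract antipode. -/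

section Drinfeld

variable {K A : Type*} [Field K]
  [NonUnitalRing A] [Module K A] [IsScalarTower K A A] [SMulCommClass K A A]

/-- `S` behaves like an antipode for the family of multipliers `D a`: the contraction `S(x) y` is
invariant under left multiplication by `D a`, and every invariant map exchanges `c ⊗ 1` with
`1 ⊗ S(c)`. -/
structure IsAntipodeFor (D : A → Mult K (A ⊗[K] A)) (ε : A → K) (S : AntiAut K A) : Prop where
  contractLeft_left : ∀ a w, S.contractLeft ((D a).left w) = ε a • S.contractLeft w
  exchange : ∀ F : A ⊗[K] A →ₗ[K] A, (∀ a w, F ((D a).left w) = ε a • F w) → ∀ c w,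
    F ((Mult.tmul (Mult.of K c) 1).left w) = F ((Mult.tmul 1 (Mult.of K (S.toLinearEquiv c))).left w)

theorem AntiAut.contractLeft_symm (S : AntiAut K A) (w : A ⊗[K] A) : S.symm.contractLeft w =
    S.toLinearEquiv.symm (S.contractLeft (TensorProduct.comm K A A w)) := by
  induction w with
  | zero => simp
  | add z z' h h' => simp only [map_add, h, h']
  | tmul a b => simp [S.symm_map_mul]

theorem comm_left_tmul (m n : Mult K A) (w : A ⊗[K] A) :
    TensorProduct.comm K A A ((Mult.tmul m n).left w) =
      (Mult.tmul n m).left (TensorProduct.comm K A A w) := by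
  induction w with
  | zero => simp
  | add z z' h h' => simp only [map_add, h, h']
  | tmul a b => simp

namespace IsAntipodeFor

variable {D : A → Mult K (A ⊗[K] A)} {ε : A → K} {S : AntiAut K A}

/-- The inverse of the antipode is an antipode for the co-opposite comultiplication. This makes R⁻¹
usable in place of R. -/
theorem flip (h : IsAntipodeFor D ε S) : IsAntipodeFor (fun a => (D a).flip) ε S.symm where
  contractLeft_left a w := by
    rw [AntiAut.contractLeft_symm, Mult.left_flip, AntiAut.contractLeft_symm]
    have : TensorProduct.comm K A A (TensorProduct.comm K A A
        ((D a).left (TensorProduct.comm K A A w))) = (D a).left (TensorProduct.comm K A A w) :=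
      (TensorProduct.comm K A A).symm_apply_apply _
    rw [this, h.contractLeft_left, map_smul]
  exchange F hF c w := by
    have key := h.exchange (F ∘ₗ (TensorProduct.comm K A A).toLinearMap) (fun a w => by
      have := hF a (TensorProduct.comm K A A w)
      have e : TensorProduct.comm K A A (TensorProduct.comm K A A w) = w :=
        (TensorProduct.comm K A A).symm_apply_apply _
      simpa [e] using this) (S.toLinearEquiv.symm c) (TensorProduct.comm K A A w)
    have e : TensorProduct.comm K A A (TensorProduct.comm K A A w) = w :=
        (TensorProduct.comm K A A).symm_apply_apply _
    simp only [LinearMap.comp_apply, LinearEquiv.coe_coe, comm_left_tmul, e,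
      LinearEquiv.apply_symm_apply] at key
    exact key.symm

/-- Drinfeld's element `u = S(R⁽²⁾) R⁽¹⁾` exists and satisfies `u c = S²(c) u`. -/
theorem exists_drinfeld (h : IsAntipodeFor D ε S) (hA : NondegenerateMul A)
    (hI : IsIdempotentAlg A) {R : Mult K (A ⊗[K] A)} (hR : ∀ a, R * D a = (D a).flip * R) :
    ∃ u : Mult K A, IsAntipodeSnd S R u ∧
      ∀ c, u * Mult.of K c = Mult.of K (S.toLinearEquiv (S.toLinearEquiv c)) * u := by
  have hA2 : NondegenerateMul (A ⊗[K] A) := nondegenerateMul_tensor hA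
  -- F(a ⊗ S⁻¹(b)) will be b u a. It is invariant because R turns D(a) into its flip, τ undoes the
  -- flip, and the contraction absorbs D(a).
  let F : A ⊗[K] A →ₗ[K] A := S.contractLeft ∘ₗ (TensorProduct.comm K A A).toLinearMap ∘ₗ R.left
  have hF : ∀ a w, F ((D a).left w) = ε a • F w := by
    intro a w
    have e : ∀ w, TensorProduct.comm K A A (TensorProduct.comm K A A w) = w := fun w =>
      (TensorProduct.comm K A A).symm_apply_apply w
    simp only [F, LinearMap.comp_apply, LinearEquiv.coe_coe]
    rw [← Mult.left_mul, hR, Mult.left_mul, Mult.left_flip, e, h.contractLeft_left]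
  have hx := h.exchange F hF
  let U : A →ₗ[K] A →ₗ[K] A := LinearMap.mk₂ K (fun b a => F (a ⊗ₜ S.toLinearEquiv.symm b))
    (by simp [TensorProduct.tmul_add]) (by simp) (by simp [TensorProduct.add_tmul])
    (by intro c a b; rw [← TensorProduct.smul_tmul', map_smul])
  have hU : ∀ b a, U b a = F (a ⊗ₜ S.toLinearEquiv.symm b) := fun b a => rfl
  have hU1 : ∀ b b' a, U (b * b') a = b * U b' a := by
    intro b b' a
    have e : a ⊗ₜ[K] S.toLinearEquiv.symm (b * b') =
        (Mult.tmul 1 (Mult.of K (S.toLinearEquiv.symm b))).right (a ⊗ₜ S.toLinearEquiv.symm b') := by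
      simp [S.symm_map_mul]
    rw [hU, hU, e]
    simp only [F, LinearMap.comp_apply, LinearEquiv.coe_coe]
    rw [Mult.left_right_comm hA2]
    generalize R.left _ = z
    induction z with
    | zero => simp
    | add z z' h h' => simp only [map_add, h, h', mul_add]
    | tmul x y => simp [S.map_mul, mul_assoc]
  have hU2 : ∀ b a a', U b (a * a') = U b a * a' := by
    intro b a a'
    have e : (a * a') ⊗ₜ[K] S.toLinearEquiv.symm b =
        (Mult.tmul (Mult.of K a') 1).right (a ⊗ₜ S.toLinearEquiv.symm b) := by
      simp
    rw [hU, hU, e]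
    simp only [F, LinearMap.comp_apply, LinearEquiv.coe_coe]
    rw [Mult.left_right_comm hA2]
    generalize R.left _ = z
    induction z with
    | zero => simp
    | add z z' h h' => simp only [map_add, h, h', add_mul]
    | tmul x y => simp [mul_assoc]
  -- The exchange property replaces c ⊗ 1 by 1 ⊗ S(c), and S(c)S⁻¹(b) = S⁻¹(b S²(c)).
  have hU3 : ∀ b c a, U b (c * a) = U (b * S.toLinearEquiv (S.toLinearEquiv c)) a := by
    intro b c a
    have := hx c (a ⊗ₜ S.toLinearEquiv.symm b)
    simpa [hU, S.symm_map_mul] using this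
  -- Moving c across with `hU3` turns U(b, ca) into b times an element independent of b, and U(bc,
  -- a) into an element independent of a times a. Both one-sided multiplications of u therefore
  -- exist on products, which span A.
  obtain ⟨u, hu⟩ := hA.exists_mult U
    (fun a => hI.induction (p := fun a => ∃ x, ∀ b, U b a = b * x) (fun c a => ⟨_, fun b => (hU3 b c a).trans (hU1 _ _ _)⟩)
      (fun a a' ⟨x, hx⟩ ⟨x', hx'⟩ => ⟨x + x', fun b => by rw [map_add, hx, hx', mul_add]⟩) a)
    (fun b => hI.induction (p := fun b => ∃ y, ∀ a, U b a = y * a) (fun b c => by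
        refine ⟨U b (S.toLinearEquiv.symm (S.toLinearEquiv.symm c)), fun a => ?_⟩
        rw [← hU2, hU3]
        simp)
      (fun a a' ⟨x, hx⟩ ⟨x', hx'⟩ => ⟨x + x', fun b => by
        rw [map_add, LinearMap.add_apply, hx, hx', add_mul]⟩) b)
  refine ⟨u, fun a b => hu a b, fun c => hA.mult_ext_left fun a => hA.left_cancel fun b => ?_⟩
  rw [Mult.left_mul, Mult.left_mul, Mult.left_of, Mult.left_of, hu, hU3, ← hu, mul_assoc]

/-- Drinfeld's element is invertible when `R` is. -/
theorem exists_unit_drinfeld (h : IsAntipodeFor D ε S) (hA : NondegenerateMul A)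
    (hI : IsIdempotentAlg A) {R R' : Mult K (A ⊗[K] A)} (hRR' : R * R' = 1) (hR'R : R' * R = 1)
    (hR : ∀ a, R * D a = (D a).flip * R) :
    ∃ u : (Mult K A)ˣ, IsAntipodeSnd S R u.val ∧
      ∀ c, u.val * Mult.of K c = Mult.of K (S.toLinearEquiv (S.toLinearEquiv c)) * u.val := by
  obtain ⟨u, hu, huc⟩ := h.exists_drinfeld hA hI hR
  obtain ⟨v, hv, hvc⟩ := h.flip.exists_drinfeld (R := R') hA hI (fun a => by
    rw [Mult.flip_flip]
    calc R' * (D a).flip = R' * ((D a).flip * R) * R' := by simp [mul_assoc, hRR']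
      _ = D a * R' := by rw [← hR, ← mul_assoc, hR'R, one_mul])
  simp only [AntiAut.toLinearEquiv_symm] at hvc
  -- On z = c ⊗ d this is b u S⁻¹(d) c = b S(d) u c. For z = R'(a ⊗ S(b')) the left side contains u
  -- v, while on the right R meets R' and cancels.
  have hz : ∀ b z, b * u.left (S.symm.contractLeft (TensorProduct.comm K A A z)) =
      S.contractLeft (TensorProduct.comm K A A
        (R.left ((Mult.tmul 1 (Mult.of K (S.toLinearEquiv.symm b))).right z))) := by
    intro b z
    induction z with
    | zero => simp
    | add z z' h h' => simp only [map_add, mul_add, h, h']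
    | tmul c d =>
      have e := congrArg (fun m => b * m.left c) (huc (S.toLinearEquiv.symm d))
      simp only [Mult.left_mul, Mult.left_of, LinearEquiv.apply_symm_apply] at e
      rw [← mul_assoc, hu c] at e
      rw [TensorProduct.comm_tmul, S.symm.contractLeft_tmul]
      refine e.trans ?_
      simp [S.symm_map_mul, AntiAut.contractLeft]
  have huv : u * v = 1 := by
    refine hA.mult_ext_left fun a => hA.left_cancel fun b =>
      hA.left_cancel fun c => ?_
    obtain ⟨b, rfl⟩ := S.toLinearEquiv.surjective b
    obtain ⟨b, rfl⟩ := S.toLinearEquiv.surjective b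
    have e := congrArg (fun m => c * m.left (v.left a)) (huc b)
    simp only [Mult.left_mul, Mult.left_of, hv a b] at e
    rw [Mult.left_mul, Mult.left_one, ← e]
    refine (hz c _).trans ?_
    rw [← Mult.left_right_comm (nondegenerateMul_tensor hA), ← Mult.left_mul, hRR']
    simp [S.map_mul, mul_assoc]
  -- So far v is only a right inverse. Extending u c = S²(c) u to multipliers gives S²(v) u = u v =
  -- 1, hence a left inverse, which must equal v.
  have hS : ∀ m : Mult K A, u * m = S.extend (S.extend m) * u := by
    intro m
    refine hA.mult_ext_left fun a => Mult.of_injective (K := K) hA ?_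
    rw [← Mult.mul_of, ← Mult.mul_of, mul_assoc, mul_assoc, huc, Mult.mul_of, huc, S.apply_left,
      S.apply_right, ← mul_assoc, Mult.mul_of]
  have hvu : S.extend (S.extend v) * u = 1 := by rw [← hS, huv]
  exact ⟨⟨u, v, huv, by rwa [← left_inv_eq_right_inv hvu huv]⟩, hu, huc⟩

end IsAntipodeFor

end Drinfeld

/-! ### The antipode of A, and its conjugate by Q as an antipode for Δ^J. -/

section Untwisted

variable {K A : Type*} [Field K]
  [NonUnitalRing A] [Module K A] [IsScalarTower K A A] [SMulCommClass K A A]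

namespace RegularMultiplierHopfAlgebra

variable {H : RegularMultiplierHopfAlgebra K A} {ε : A →ₙₐ[K] K} {S : AntiAut K A}

theorem T₁_mul (H : RegularMultiplierHopfAlgebra K A) (a b : A) (w : A ⊗[K] A) :
    H.T₁ (a ⊗ₜ b) * w = (H.Δ a).left ((Mult.tmul 1 (Mult.of K b)).left w) := by
  rw [← Mult.left_mul, ← H.T₁_spec, Mult.left_of]

theorem mul_T₂ (H : RegularMultiplierHopfAlgebra K A) (a b : A) (w : A ⊗[K] A) :
    w * H.T₂ (a ⊗ₜ b) = (H.Δ b).right ((Mult.tmul (Mult.of K a) 1).right w) := by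
  rw [← Mult.right_mul, ← H.T₂_spec, Mult.right_of]

/-- If ε vanished, the counit identity would make every product zero. An element of counit 1 later
stands in for the missing unit. -/
theorem IsCounit.eq_zero_or (hε : H.IsCounit ε) : (∀ a : A, a = 0) ∨ ∃ q, ε q = 1 := by
  by_cases h : ∃ q, ε q ≠ 0
  · obtain ⟨q, hq⟩ := h
    exact Or.inr ⟨(ε q)⁻¹ • q, by simp [hq]⟩
  · push Not at h
    refine Or.inl fun a => H.nondegenerate.1 a fun b => ?_
    rw [← hε.1]
    generalize H.T₁ _ = z
    induction z with
    | zero => simp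
    | add x y hx hy => rw [map_add, hx, hy, add_zero]
    | tmul x y => simp [counitLeft, h]

/-- Write q ⊗ a as a sum of Δ(x)(1 ⊗ y) and apply ε ⊗ ι. -/
theorem IsCounit.isIdempotentAlg (hε : H.IsCounit ε) : IsIdempotentAlg A := by
  rw [IsIdempotentAlg, eq_top_iff]
  rintro a -
  obtain h | ⟨q, hq⟩ := hε.eq_zero_or
  · rw [h a]
    exact zero_mem _
  · have ha : a = counitLeft ε (H.T₁ (H.T₁.symm (q ⊗ₜ a))) := by simp [counitLeft, hq]
    rw [ha]
    generalize H.T₁.symm _ = z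
    induction z with
    | zero => simp
    | add x y hx hy => simpa only [map_add] using add_mem hx hy
    | tmul x y =>
      rw [hε.1]
      exact AddSubmonoid.subset_closure ⟨x, y, rfl⟩

theorem IsAntipode.contractLeft_left (hS : H.IsAntipode ε S) (hI : IsIdempotentAlg A) (a : A)
    (w : A ⊗[K] A) : S.contractLeft ((H.Δ a).left w) = ε a • S.contractLeft w := by
  induction w using IsIdempotentAlg.tensor_induction (K := K) hI with
  | hmul x y x' y' =>
    have e : x ⊗ₜ[K] y * x' ⊗ₜ y' =
        (Mult.tmul 1 (Mult.of K y)).left ((x * x') ⊗ₜ[K] y') := by simp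
    have := hS.1 a y
    rw [e, ← T₁_mul, S.contractLeft_mul_tmul]
    rw [AntiAut.contractLeft, LinearMap.comp_apply, this]
    simp [smul_mul_assoc, mul_smul_comm, mul_assoc]
  | hadd w w' h h' =>
    simp only [map_add, h, h', smul_add]

theorem IsAntipode.contractRight_right (hS : H.IsAntipode ε S) (hI : IsIdempotentAlg A) (a : A)
    (w : A ⊗[K] A) : S.contractRight ((H.Δ a).right w) = ε a • S.contractRight w := by
  induction w using IsIdempotentAlg.tensor_induction (K := K) hI with
  | hmul x y x' y' =>
    have e : x ⊗ₜ[K] y * x' ⊗ₜ y' =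
        (Mult.tmul (Mult.of K x') 1).right (x ⊗ₜ[K] (y * y')) := by simp
    have := hS.2 x' a
    rw [e, ← mul_T₂, S.contractRight_tmul_mul]
    rw [AntiAut.contractRight, LinearMap.comp_apply, this]
    simp [smul_mul_assoc, mul_smul_comm, mul_assoc]
  | hadd w w' h h' =>
    simp only [map_add, h, h', smul_add]

/-- It suffices to take z = Δ(x)(1 ⊗ y), where both sides are ε(x) G((1 ⊗ y)w). An invariant map
thus sees a left factor z only through its contraction. -/
theorem IsAntipode.invariant_mul (hS : H.IsAntipode ε S) (G : A ⊗[K] A →ₗ[K] A)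
    (hG : ∀ a w, G ((H.Δ a).left w) = ε a • G w) (z w : A ⊗[K] A) :
    G (z * w) = G ((Mult.tmul 1 (Mult.of K (S.contractLeft z))).left w) := by
  obtain ⟨p, rfl⟩ := H.T₁.surjective z
  induction p with
  | zero => simp
  | add x y hx hy => simp only [map_add, add_mul, hx, hy, Mult.left_add]
  | tmul x y =>
    have := hS.1 x y
    rw [T₁_mul, hG, AntiAut.contractLeft, LinearMap.comp_apply, this]
    simp

/-- The antipode of `A^J` is an antipode for `Δ^J`, when `Q = S(J⁽¹⁾) J⁽²⁾` is invertible. -/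
theorem IsAntipode.isAntipodeFor_conj (hS : H.IsAntipode ε S) (hI : IsIdempotentAlg A)
    (J : (Mult K (A ⊗[K] A))ˣ) (Q : (Mult K A)ˣ) (hQ : IsAntipodeFst S J.val Q.val) :
    IsAntipodeFor (fun a => (J⁻¹ : (Mult K (A ⊗[K] A))ˣ).val * H.Δ a * J.val) ε
      (S.conj H.nondegenerate Q) := by
  have hJ : ∀ x y, S.contractLeft (J.val.left (x ⊗ₜ y)) = S.toLinearEquiv x * Q.val.left y := by
    intro x y
    have := hQ y (S.toLinearEquiv x)
    rw [LinearEquiv.symm_apply_apply] at this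
    exact this.symm
  have hSJ : ∀ a, (S.conj H.nondegenerate Q).toLinearEquiv a =
      (Q⁻¹ : (Mult K A)ˣ).val.left (Q.val.right (S.toLinearEquiv a)) := fun a => rfl
  have hQQ : ∀ a, Q.val.left ((Q⁻¹ : (Mult K A)ˣ).val.left a) = a := fun a => by
    rw [← Mult.left_mul, Units.mul_inv, Mult.left_one]
  have hQQ' : ∀ a, (Q⁻¹ : (Mult K A)ˣ).val.left (Q.val.left a) = a := fun a => by
    rw [← Mult.left_mul, Units.inv_mul, Mult.left_one]
  have hJJ : ∀ a, J.val.left ((J⁻¹ : (Mult K (A ⊗[K] A))ˣ).val.left a) = a := fun a => by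
    rw [← Mult.left_mul, Units.mul_inv, Mult.left_one]
  have hJJ' : ∀ a, (J⁻¹ : (Mult K (A ⊗[K] A))ˣ).val.left (J.val.left a) = a := fun a => by
    rw [← Mult.left_mul, Units.inv_mul, Mult.left_one]
  constructor
  · have key : ∀ w, (S.conj H.nondegenerate Q).contractLeft w =
        (Q⁻¹ : (Mult K A)ˣ).val.left (S.contractLeft (J.val.left w)) := by
      intro w
      induction w with
      | zero => simp
      | add x y hx hy => simp only [map_add, hx, hy]
      | tmul x y =>
        rw [hJ, AntiAut.contractLeft_tmul, hSJ, ← Mult.left_mul_apply, ← Mult.mul_left_apply]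
    intro a w
    rw [key, key, Mult.left_mul, Mult.left_mul, hJJ, hS.contractLeft_left hI, map_smul]
  · intro F hF c w
    -- Undoing the twist turns invariance under Δ^J into invariance under Δ.
    let G := F ∘ₗ (J⁻¹ : (Mult K (A ⊗[K] A))ˣ).val.left
    have hFG : ∀ w, F w = G (J.val.left w) := fun w => by
      simp [G, hJJ']
    have hG : ∀ a w, G ((H.Δ a).left w) = ε a • G w := by
      intro a w
      have := hF a ((J⁻¹ : (Mult K (A ⊗[K] A))ˣ).val.left w)
      rw [Mult.left_mul, Mult.left_mul, hJJ] at this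
      exact this
    -- F depends on x ⊗ y only through S(x)Qy, and S(cx)Qy = S(x) Q S^J(c) y; this is the exchange
    -- property.
    have key : ∀ x y w, F (x ⊗ₜ y * w) =
        G ((Mult.tmul 1 (Mult.of K (S.toLinearEquiv x * Q.val.left y))).left w) := by
      intro x y w
      rw [hFG, Mult.left_mul_apply, hS.invariant_mul G hG, hJ]
    induction w using IsIdempotentAlg.tensor_induction (K := K) hI with
    | hmul x y x' y' =>
      rw [Mult.left_mul_apply, Mult.left_mul_apply, Mult.left_tmul, Mult.left_tmul, key, key]
      congr 5
      simp only [Mult.left_of, Mult.left_one]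
      rw [hSJ, Mult.left_mul_apply, hQQ, S.map_mul, mul_assoc, Mult.mul_left_apply]
    | hadd w w' h h' =>
      simp only [map_add, h, h']

end RegularMultiplierHopfAlgebra

end Untwisted

/-! ### Existence of S(X⁽¹⁾)X⁽²⁾ and X⁽¹⁾S(X⁽²⁾) for covered X. -/

section Covering

variable {K A : Type*} [Field K]
  [NonUnitalRing A] [Module K A] [IsScalarTower K A A] [SMulCommClass K A A]

/-- This and the next three lemmas supply the one-sided factorizations required by `exists_mult`: a
factor in A on one leg lets the multiplier on the other leg be absorbed into an element of A. -/
theorem contractLeft_of_mem_multTensor (S : AntiAut K A) (d : A) {X : Mult K (A ⊗[K] A)}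
    (hX : X ∈ multTensor (K := K) (A := A)) :
    ∃ x, ∀ c, S.contractLeft (X.left (c ⊗ₜ d)) = S.toLinearEquiv c * x := by
  induction hX using Submodule.span_induction with
  | mem X hX =>
    obtain ⟨m, a, rfl⟩ := hX
    exact ⟨(S.extend m).left (a * d), fun c => by simp [S.apply_left, Mult.mul_left_apply]⟩
  | zero => exact ⟨0, fun c => by simp⟩
  | add X Y _ _ hX hY =>
    obtain ⟨x, hx⟩ := hX
    obtain ⟨y, hy⟩ := hY
    exact ⟨x + y, fun c => by simp [hx, hy, mul_add]⟩
  | smul r X _ hX =>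
    obtain ⟨x, hx⟩ := hX
    exact ⟨r • x, fun c => by simp [hx, mul_smul_comm]⟩

theorem contractLeft_of_mem_tensorMult (S : AntiAut K A) (c : A) {X : Mult K (A ⊗[K] A)}
    (hX : X ∈ tensorMult (K := K) (A := A)) :
    ∃ y, ∀ d, S.contractLeft (X.left (c ⊗ₜ d)) = y * d := by
  induction hX using Submodule.span_induction with
  | mem X hX =>
    obtain ⟨a, m, rfl⟩ := hX
    exact ⟨m.right (S.toLinearEquiv (a * c)), fun d => by simp [Mult.mul_left_apply]⟩
  | zero => exact ⟨0, fun c => by simp⟩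
  | add X Y _ _ hX hY =>
    obtain ⟨x, hx⟩ := hX
    obtain ⟨y, hy⟩ := hY
    exact ⟨x + y, fun c => by simp [hx, hy, add_mul]⟩
  | smul r X _ hX =>
    obtain ⟨x, hx⟩ := hX
    exact ⟨r • x, fun c => by simp [hx, smul_mul_assoc]⟩

theorem contractRight_of_mem_multTensor (S : AntiAut K A) (d : A) {X : Mult K (A ⊗[K] A)}
    (hX : X ∈ multTensor (K := K) (A := A)) :
    ∃ x, ∀ c, S.contractRight (X.right (c ⊗ₜ d)) = c * x := by
  induction hX using Submodule.span_induction with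
  | mem X hX =>
    obtain ⟨m, a, rfl⟩ := hX
    exact ⟨m.left (S.toLinearEquiv (d * a)), fun c => by simp [Mult.mul_left_apply]⟩
  | zero => exact ⟨0, fun c => by simp⟩
  | add X Y _ _ hX hY =>
    obtain ⟨x, hx⟩ := hX
    obtain ⟨y, hy⟩ := hY
    exact ⟨x + y, fun c => by simp [hx, hy, mul_add]⟩
  | smul r X _ hX =>
    obtain ⟨x, hx⟩ := hX
    exact ⟨r • x, fun c => by simp [hx, mul_smul_comm]⟩

theorem contractRight_of_mem_tensorMult (S : AntiAut K A) (c : A) {X : Mult K (A ⊗[K] A)}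
    (hX : X ∈ tensorMult (K := K) (A := A)) :
    ∃ y, ∀ d, S.contractRight (X.right (c ⊗ₜ d)) = y * S.toLinearEquiv d := by
  induction hX using Submodule.span_induction with
  | mem X hX =>
    obtain ⟨a, m, rfl⟩ := hX
    exact ⟨(S.extend m).right (c * a), fun d => by simp [S.apply_right, Mult.mul_left_apply]⟩
  | zero => exact ⟨0, fun c => by simp⟩
  | add X Y _ _ hX hY =>
    obtain ⟨x, hx⟩ := hX
    obtain ⟨y, hy⟩ := hY
    exact ⟨x + y, fun c => by simp [hx, hy, add_mul]⟩
  | smul r X _ hX =>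
    obtain ⟨x, hx⟩ := hX
    exact ⟨r • x, fun c => by simp [hx, smul_mul_assoc]⟩

/-- The multiplier `S(X⁽¹⁾) X⁽²⁾` exists for a covered multiplier `X`. -/
theorem IsCovered.exists_contractLeft {X : Mult K (A ⊗[K] A)} (hX : IsCovered X)
    (hA : NondegenerateMul A) (hI : IsIdempotentAlg A) (S : AntiAut K A) :
    ∃ Q : Mult K A, IsAntipodeFst S X Q := by
  let U : A →ₗ[K] A →ₗ[K] A := LinearMap.mk₂ K
    (fun b a => S.contractLeft (X.left (S.toLinearEquiv.symm b ⊗ₜ a)))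
    (by simp [TensorProduct.add_tmul])
    (by intro c a b; rw [map_smul, ← TensorProduct.smul_tmul', map_smul, map_smul])
    (by simp [TensorProduct.tmul_add]) (by simp)
  refine hA.exists_mult U (fun a => ?_) (fun b => ?_)
  · induction a using hI.induction with
    | hmul a d =>
      obtain ⟨x, hx⟩ := contractLeft_of_mem_multTensor S d (hX a).1
      exact ⟨x, fun b => by simpa [U] using hx (S.toLinearEquiv.symm b)⟩
    | hadd a a' h h' =>
      obtain ⟨x, hx⟩ := h
      obtain ⟨y, hy⟩ := h'
      exact ⟨x + y, fun c => by simp only [map_add, hx, hy, mul_add]⟩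
  · induction b using hI.induction with
    | hmul b c =>
      obtain ⟨x, hx⟩ := contractLeft_of_mem_tensorMult S (S.toLinearEquiv.symm b)
        (hX (S.toLinearEquiv.symm c)).2.2.1
      exact ⟨x, fun a => by simpa [U, S.symm_map_mul] using hx a⟩
    | hadd a a' h h' =>
      obtain ⟨x, hx⟩ := h
      obtain ⟨y, hy⟩ := h'
      exact ⟨x + y, fun c => by simp only [map_add, LinearMap.add_apply, hx, hy, add_mul]⟩

/-- The multiplier `X⁽¹⁾ S(X⁽²⁾)` exists for a covered multiplier `X`. -/
theorem IsCovered.exists_contractRight {X : Mult K (A ⊗[K] A)} (hX : IsCovered X)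
    (hA : NondegenerateMul A) (hI : IsIdempotentAlg A) (S : AntiAut K A) :
    ∃ P : Mult K A, ∀ b a,
      b * P.left (S.toLinearEquiv a) = S.contractRight (X.right (b ⊗ₜ a)) := by
  let U : A →ₗ[K] A →ₗ[K] A := LinearMap.mk₂ K
    (fun b a => S.contractRight (X.right (b ⊗ₜ S.toLinearEquiv.symm a)))
    (by simp [TensorProduct.add_tmul])
    (by intro c a b; rw [← TensorProduct.smul_tmul', map_smul, map_smul])
    (by simp [TensorProduct.tmul_add]) (by simp)
  obtain ⟨P, hP⟩ := hA.exists_mult U (fun a => by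
    induction a using hI.induction with
    | hmul a d =>
      obtain ⟨x, hx⟩ := contractRight_of_mem_multTensor S (S.toLinearEquiv.symm d)
        (hX (S.toLinearEquiv.symm a)).2.1
      exact ⟨x, fun b => by simpa [U, S.symm_map_mul] using hx b⟩
    | hadd a a' h h' =>
      obtain ⟨x, hx⟩ := h
      obtain ⟨y, hy⟩ := h'
      exact ⟨x + y, fun c => by simp only [map_add, hx, hy, mul_add]⟩) (fun b => by
    induction b using hI.induction with
    | hmul b c =>
      obtain ⟨x, hx⟩ := contractRight_of_mem_tensorMult S b (hX c).2.2.2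
      exact ⟨x, fun a => by simpa [U] using hx (S.toLinearEquiv.symm a)⟩
    | hadd a a' h h' =>
      obtain ⟨x, hx⟩ := h
      obtain ⟨y, hy⟩ := h'
      exact ⟨x + y, fun c => by simp only [map_add, LinearMap.add_apply, hx, hy, add_mul]⟩)
  refine ⟨P, fun b a => ?_⟩
  rw [hP]
  simp [U]

end Covering

/-! ### Invertibility of Q from the cocycle identity. -/

section Twist

variable {K A : Type*} [Field K]
  [NonUnitalRing A] [Module K A] [IsScalarTower K A A] [SMulCommClass K A A]

namespace RegularMultiplierHopfAlgebra

variable {H : RegularMultiplierHopfAlgebra K A} {ε : A →ₙₐ[K] K} {S : AntiAut K A}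

theorem left_comulLeft_tmul (H : RegularMultiplierHopfAlgebra K A) (a b : A) (v : A ⊗[K] A)
    (c : A) : (H.comulLeft (a ⊗ₜ b)).left (TensorProduct.assoc K A A A (v ⊗ₜ c)) =
      TensorProduct.assoc K A A A ((H.Δ a).left v ⊗ₜ (b * c)) := by
  simp [comulLeft, deltaTensorId, Mult.assocLinear, Mult.assoc, Mult.congr]

theorem left_comulRight_tmul (H : RegularMultiplierHopfAlgebra K A) (a b c : A)
    (v : A ⊗[K] A) : (H.comulRight (a ⊗ₜ b)).left (c ⊗ₜ v) = (a * c) ⊗ₜ (H.Δ b).left v := by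
  simp [comulRight, idTensorDelta]

theorem left_leg12_assoc (X : Mult K (A ⊗[K] A)) (v : A ⊗[K] A) (c : A) :
    X.leg12.left (TensorProduct.assoc K A A A (v ⊗ₜ c)) =
      TensorProduct.assoc K A A A (X.left v ⊗ₜ c) := by
  simp [Mult.leg12, Mult.assoc, Mult.congr]

theorem left_leg23_tmul (X : Mult K (A ⊗[K] A)) (c : A) (v : A ⊗[K] A) :
    X.leg23.left (c ⊗ₜ v) = c ⊗ₜ X.left v := by
  simp [Mult.leg23]

/-- `Δ(A)(A ⊗ A)` spans `A ⊗ A`. -/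
theorem induction_comul (H : RegularMultiplierHopfAlgebra K A) (hI : IsIdempotentAlg A)
    {p : A ⊗[K] A → Prop} (hmul : ∀ a v, p ((H.Δ a).left v))
    (hadd : ∀ v w, p v → p w → p (v + w)) (v : A ⊗[K] A) : p v := by
  induction v using IsIdempotentAlg.tensor_induction (K := K) hI with
  | hmul x y x' y' =>
    obtain ⟨q, hq⟩ := H.T₁.surjective (x ⊗ₜ y)
    rw [← hq]
    clear hq
    induction q with
    | zero => simpa using hmul 0 0
    | add q r hq hr => simpa only [map_add, add_mul] using hadd _ _ hq hr
    | tmul a b =>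
      rw [T₁_mul]
      exact hmul _ _
  | hadd v w hv hw => exact hadd v w hv hw

/-- Linear maps that agree on `Δ₁₃(z) w` agree. -/
theorem comulLeft_hom_ext (H : RegularMultiplierHopfAlgebra K A) (hI : IsIdempotentAlg A)
    {V : Type*} [AddCommGroup V] [Module K V] {F G : A ⊗[K] (A ⊗[K] A) →ₗ[K] V}
    (h : ∀ z w, F ((H.comulLeft z).left w) = G ((H.comulLeft z).left w)) : F = G := by
  have key : ∀ v c, F (TensorProduct.assoc K A A A (v ⊗ₜ c)) =
      G (TensorProduct.assoc K A A A (v ⊗ₜ c)) := by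
    intro v c
    induction c using hI.induction with
    | hmul b c =>
      induction v using H.induction_comul hI with
      | hmul a v =>
        simpa only [left_comulLeft_tmul] using
          h (a ⊗ₜ b) (TensorProduct.assoc K A A A (v ⊗ₜ c))
      | hadd v w hv hw => simp only [TensorProduct.add_tmul, map_add, hv, hw]
    | hadd b c hb hc => simp only [TensorProduct.tmul_add, map_add, hb, hc]
  ext x y z
  exact key (x ⊗ₜ y) z

theorem comulRight_hom_ext (H : RegularMultiplierHopfAlgebra K A) (hI : IsIdempotentAlg A)
    {V : Type*} [AddCommGroup V] [Module K V] {F G : A ⊗[K] (A ⊗[K] A) →ₗ[K] V}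
    (h : ∀ z w, F ((H.comulRight z).left w) = G ((H.comulRight z).left w)) : F = G := by
  have key : ∀ c v, F (c ⊗ₜ v) = G (c ⊗ₜ v) := by
    intro c v
    induction c using hI.induction with
    | hmul b c =>
      induction v using H.induction_comul hI with
      | hmul a v => simpa only [left_comulRight_tmul] using h (b ⊗ₜ a) (c ⊗ₜ v)
      | hadd v w hv hw => simp only [TensorProduct.tmul_add, map_add, hv, hw]
    | hadd b c hb hc => simp only [TensorProduct.add_tmul, map_add, hb, hc]
  ext x y z
  exact key x (y ⊗ₜ z)

/-- `x ⊗ y ⊗ z ↦ S(x) y ⊗ z`. -/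
def contractFst (S : AntiAut K A) : A ⊗[K] (A ⊗[K] A) →ₗ[K] A ⊗[K] A :=
  TensorProduct.map S.contractLeft LinearMap.id ∘ₗ (TensorProduct.assoc K A A A).symm.toLinearMap

/-- `x ⊗ y ⊗ z ↦ x ⊗ S(y) z`. -/
def contractSnd (S : AntiAut K A) : A ⊗[K] (A ⊗[K] A) →ₗ[K] A ⊗[K] A :=
  TensorProduct.map LinearMap.id S.contractLeft

theorem contractFst_assoc (S : AntiAut K A) (v : A ⊗[K] A) (c : A) :
    contractFst S (TensorProduct.assoc K A A A (v ⊗ₜ c)) = S.contractLeft v ⊗ₜ c := by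
  simp [contractFst]

theorem contractFst_tmul (S : AntiAut K A) (x : A) (v : A ⊗[K] A) :
    contractFst S (x ⊗ₜ v) =
      (Mult.tmul (Mult.of K (S.toLinearEquiv x)) 1).left v := by
  induction v with
  | zero => simp
  | add v w hv hw => simp only [TensorProduct.tmul_add, map_add, hv, hw]
  | tmul y z => simp [contractFst]

theorem contractSnd_tmul (S : AntiAut K A) (x : A) (v : A ⊗[K] A) :
    contractSnd S (x ⊗ₜ v) = x ⊗ₜ S.contractLeft v := by
  simp [contractSnd]

/-- With S(z) in the third leg, S(y)S(z) = S(zy) turns the contraction into a left multiplication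
followed by the injective map ι ⊗ S. -/
theorem contractSnd_assoc (S : AntiAut K A) (v : A ⊗[K] A) (z : A) :
    contractSnd S (TensorProduct.assoc K A A A (v ⊗ₜ S.toLinearEquiv z)) =
      S.toLinearEquiv.lTensor A ((Mult.tmul 1 (Mult.of K z)).left v) := by
  induction v with
  | zero => simp
  | add v w hv hw => simp only [TensorProduct.add_tmul, map_add, hv, hw]
  | tmul x y => simp [contractSnd, S.map_mul]

/-- Contracting the first two legs absorbs Δ(a), and the scalar ε(a) passes to the third leg. -/
theorem IsAntipode.contractFst_comulLeft (hS : H.IsAntipode ε S) (hI : IsIdempotentAlg A)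
    (z : A ⊗[K] A) (w : A ⊗[K] (A ⊗[K] A)) : contractFst S ((H.comulLeft z).left w) =
      (Mult.tmul 1 (Mult.of K (counitLeft ε z))).left (contractFst S w) := by
  obtain ⟨w, rfl⟩ := (TensorProduct.assoc K A A A).surjective w
  induction w with
  | zero => simp
  | add v w hv hw => simp only [map_add, hv, hw]
  | tmul v c =>
    induction z with
    | zero => simp
    | add x y hx hy => simp only [map_add, Mult.left_add, hx, hy]
    | tmul a b =>
      rw [left_comulLeft_tmul, contractFst_assoc, contractFst_assoc, hS.contractLeft_left hI]
      simp [counitLeft, TensorProduct.smul_tmul]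

theorem IsAntipode.contractSnd_comulRight (hS : H.IsAntipode ε S) (hI : IsIdempotentAlg A)
    (z : A ⊗[K] A) (w : A ⊗[K] (A ⊗[K] A)) : contractSnd S ((H.comulRight z).left w) =
      (Mult.tmul (Mult.of K (counitRight ε z)) 1).left (contractSnd S w) := by
  induction w with
  | zero => simp
  | add v w hv hw => simp only [map_add, hv, hw]
  | tmul c v =>
    induction z with
    | zero => simp
    | add x y hx hy =>
      simp only [map_add, Mult.left_add, LinearMap.add_apply, hx, hy]
    | tmul a b =>
      rw [left_comulRight_tmul, contractSnd_tmul, contractSnd_tmul, hS.contractLeft_left hI]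
      simp [counitRight, TensorProduct.smul_tmul']

theorem left_of_isExtension {B C : Type*} [NonUnitalRing B] [Module K B] [IsScalarTower K B B]
    [SMulCommClass K B B] [NonUnitalRing C] [Module K C] [IsScalarTower K C C]
    [SMulCommClass K C C] {f : B →ₗ[K] Mult K C} {m : Mult K B} {X : Mult K C}
    (h : Mult.IsExtension f m X) (z : B) (w : C) :
    X.left ((f z).left w) = (f (m.left z)).left w := by
  rw [← (h z).1, Mult.left_mul]

theorem IsNormalized.counitLeft_left (hA : NondegenerateMul A) {X : Mult K (A ⊗[K] A)}
    (h : IsNormalized ε X) (z : A ⊗[K] A) : counitLeft ε (X.left z) = counitLeft ε z := by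
  apply Mult.of_injective (K := K) hA
  have := (h.1 z).1
  rw [one_mul] at this
  exact this.symm

theorem IsNormalized.counitRight_left (hA : NondegenerateMul A) {X : Mult K (A ⊗[K] A)}
    (h : IsNormalized ε X) (z : A ⊗[K] A) : counitRight ε (X.left z) = counitRight ε z := by
  apply Mult.of_injective (K := K) hA
  have := (h.2 z).1
  rw [one_mul] at this
  exact this.symm

/-- `m(S ⊗ ι)` annihilates `(Δ ⊗ ι)(J)`, up to the counit. -/
theorem IsAntipode.contractFst_extension (hS : H.IsAntipode ε S) (hI : IsIdempotentAlg A)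
    {J : Mult K (A ⊗[K] A)} (hJ : IsNormalized ε J) {X : Mult K (A ⊗[K] (A ⊗[K] A))}
    (hX : Mult.IsExtension H.comulLeft J X) (w : A ⊗[K] (A ⊗[K] A)) :
    contractFst S (X.left w) = contractFst S w := by
  have : contractFst S ∘ₗ X.left = contractFst S := H.comulLeft_hom_ext hI fun z w => by
    rw [LinearMap.comp_apply, left_of_isExtension hX, hS.contractFst_comulLeft hI,
      hS.contractFst_comulLeft hI, hJ.counitLeft_left H.nondegenerate]
  exact congrArg (fun f => f w) this

theorem IsAntipode.contractSnd_extension (hS : H.IsAntipode ε S) (hI : IsIdempotentAlg A)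
    {J : Mult K (A ⊗[K] A)} (hJ : IsNormalized ε J) {Y : Mult K (A ⊗[K] (A ⊗[K] A))}
    (hY : Mult.IsExtension H.comulRight J Y) (w : A ⊗[K] (A ⊗[K] A)) :
    contractSnd S (Y.left w) = contractSnd S w := by
  have : contractSnd S ∘ₗ Y.left = contractSnd S := H.comulRight_hom_ext hI fun z w => by
    rw [LinearMap.comp_apply, left_of_isExtension hY, hS.contractSnd_comulRight hI,
      hS.contractSnd_comulRight hI, hJ.counitRight_left H.nondegenerate]
  exact congrArg (fun f => f w) this

variable {J : (Mult K (A ⊗[K] A))ˣ} {Q P : Mult K A}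

/-- Contract the first two legs of (Δ ⊗ ι)(J) J¹² = (ι ⊗ Δ)(J) J²³. The factor (Δ ⊗ ι)(J)
disappears, and J²³ is moved across as J⁻¹, leaving (S(x)Q ⊗ 1)J⁻¹ as a contraction of (ι ⊗ Δ)(J).
Contracting once more with m(ι ⊗ S) gives S(x)QP on one side and, since (ι ⊗ ε)(J) = 1, S(x) on the
other. -/
theorem IsTwist.contractLeft_mul_contractRight (hJ : H.IsTwist ε J) (hε : H.IsCounit ε)
    (hS : H.IsAntipode ε S) (hQ : IsAntipodeFst S J.val Q)
    (hP : ∀ b a, b * P.left (S.toLinearEquiv a) =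
      S.contractRight ((J⁻¹ : (Mult K (A ⊗[K] A))ˣ).val.right (b ⊗ₜ a))) :
    Q * P = 1 := by
  have hA := H.nondegenerate
  have hI := hε.isIdempotentAlg
  obtain h0 | ⟨q, hq⟩ := hε.eq_zero_or
  · ext a <;> exact (h0 _).trans (h0 _).symm
  obtain ⟨X, Y, hX, hY, hXY⟩ := hJ.cocycle
  have hJQ : ∀ x y, S.contractLeft (J.val.left (x ⊗ₜ y)) = S.toLinearEquiv x * Q.left y := by
    intro x y
    have := hQ y (S.toLinearEquiv x)
    rw [LinearEquiv.symm_apply_apply] at this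
    exact this.symm
  have h1 : ∀ x v, contractFst S (J.val.leg12.left (x ⊗ₜ v)) =
      (Mult.tmul (Mult.of K (S.toLinearEquiv x) * Q) 1).left v := by
    intro x v
    induction v with
    | zero => simp
    | add v w hv hw => simp only [TensorProduct.tmul_add, map_add, hv, hw]
    | tmul y z =>
      have := left_leg12_assoc J.val (x ⊗ₜ y) z
      rw [TensorProduct.assoc_tmul] at this
      rw [this, contractFst_assoc, hJQ]
      simp
  have h2 : ∀ x v, (Mult.tmul (Mult.of K (S.toLinearEquiv x) * Q) 1 *
      (J⁻¹ : (Mult K (A ⊗[K] A))ˣ).val).left v = contractFst S (Y.left (x ⊗ₜ v)) := by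
    intro x v
    rw [Mult.left_mul, ← h1, ← hS.contractFst_extension hI hJ.counit hX, ← Mult.left_mul, hXY,
      Mult.left_mul, left_leg23_tmul, ← Mult.left_mul J.val, Units.mul_inv, Mult.left_one]
  have h3 : ∀ x x' b c, b * S.toLinearEquiv (x * x') * Q.left (P.left (S.toLinearEquiv c)) =
      b * S.toLinearEquiv (x * x') * S.toLinearEquiv c := by
    intro x x' b c
    -- The multiplier Y is controlled through its products with (ι ⊗ Δ)(z). A factor Δ(q) with ε(q)
    -- = 1 is therefore inserted on the right: J(x ⊗ q) lies in A ⊗ A, and the second contraction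
    -- removes Δ(q) at no cost.
    let Λ : A ⊗[K] A →ₗ[K] Mult K (A ⊗[K] A) := TensorProduct.lift (LinearMap.mk₂ K
      (fun p r => Mult.tmul (Mult.of K (S.toLinearEquiv (p * x'))) 1 * H.Δ r)
      (by simp [add_mul]) (by simp [smul_mul_assoc]) (by simp [mul_add])
      (by simp))
    have hΛ : ∀ p r, Λ (p ⊗ₜ r) =
      Mult.tmul (Mult.of K (S.toLinearEquiv (p * x'))) 1 * H.Δ r := fun p r => rfl
    have e1 : ∀ z v, contractFst S ((H.comulRight z).left (x' ⊗ₜ v)) = (Λ z).left v := by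
      intro z v
      induction z with
      | zero => simp
      | add x y hx hy => simp only [map_add, Mult.left_add, hx, hy]
      | tmul p r => rw [left_comulRight_tmul, contractFst_tmul, hΛ, Mult.left_mul]
    have e2 : Mult.tmul (Mult.of K (S.toLinearEquiv (x * x')) * Q) 1 *
        (J⁻¹ : (Mult K (A ⊗[K] A))ˣ).val * H.Δ q = Λ (J.val.left (x ⊗ₜ q)) := by
      refine (nondegenerateMul_tensor hA).mult_ext_left fun v => ?_
      rw [Mult.left_mul, h2, ← left_comulRight_tmul, left_of_isExtension hY, e1]
    have e3 : ∀ z, S.contractRight ((Λ z).right (b ⊗ₜ c)) =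
        b * S.toLinearEquiv (counitRight ε z * x') * S.toLinearEquiv c := by
      intro z
      induction z with
      | zero => simp
      | add x y hx hy => simp only [map_add, add_mul, mul_add, Mult.right_add, hx, hy]
      | tmul p r =>
        rw [hΛ, Mult.right_mul, hS.contractRight_right hI]
        simp [counitRight, smul_mul_assoc, mul_smul_comm]
    have e4 := congrArg (fun m => S.contractRight (m.right (b ⊗ₜ c))) e2
    simp only [e3, Mult.right_mul, hS.contractRight_right hI, Mult.right_tmul, Mult.right_of,
      Mult.right_one, ← hP, hJ.counit.counitRight_left hA, hq, one_smul] at e4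
    rw [Mult.mul_left_apply, e4]
    simp [counitRight, hq]
  refine hA.mult_ext_left fun c => hA.left_cancel fun x => hA.left_cancel fun b => ?_
  obtain ⟨x, rfl⟩ := S.toLinearEquiv.surjective x
  obtain ⟨c, rfl⟩ := S.toLinearEquiv.surjective c
  induction x using hI.induction with
  | hmul x x' => simpa only [mul_assoc, Mult.left_mul, Mult.left_one] using h3 x x' b c
  | hadd x y hx hy => simp only [map_add, add_mul, mul_add, hx, hy]

/-- Mirror image: contracting the last two legs removes (ι ⊗ Δ)(J), and the remaining contraction
removes (Δ ⊗ ι)(J) through (ε ⊗ ι)(J) = 1. -/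
theorem IsTwist.contractRight_mul_contractLeft (hJ : H.IsTwist ε J) (hε : H.IsCounit ε)
    (hS : H.IsAntipode ε S) (hQ : IsAntipodeFst S J.val Q)
    (hP : ∀ b a, b * P.left (S.toLinearEquiv a) =
      S.contractRight ((J⁻¹ : (Mult K (A ⊗[K] A))ˣ).val.right (b ⊗ₜ a))) :
    P * Q = 1 := by
  have hA := H.nondegenerate
  have hI := hε.isIdempotentAlg
  obtain h0 | ⟨q, hq⟩ := hε.eq_zero_or
  · ext a <;> exact (h0 _).trans (h0 _).symm
  obtain ⟨X, Y, hX, hY, hXY⟩ := hJ.cocycle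
  have hJQ : ∀ x y, S.contractLeft (J.val.left (x ⊗ₜ y)) = S.toLinearEquiv x * Q.left y := by
    intro x y
    have := hQ y (S.toLinearEquiv x)
    rw [LinearEquiv.symm_apply_apply] at this
    exact this.symm
  have h1 : ∀ v z z', Q.left z = S.toLinearEquiv z' →
      contractSnd S (J.val.leg23.left (TensorProduct.assoc K A A A (v ⊗ₜ z))) =
      S.toLinearEquiv.lTensor A ((Mult.tmul 1 (Mult.of K z')).left v) := by
    intro v z z' hz
    induction v with
    | zero => simp
    | add v w hv hw => simp only [TensorProduct.add_tmul, map_add, hv, hw]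
    | tmul x y =>
      rw [TensorProduct.assoc_tmul, left_leg23_tmul, contractSnd_tmul, hJQ, hz]
      simp [S.map_mul]
  have h2 : ∀ v z z', Q.left z = S.toLinearEquiv z' →
      S.toLinearEquiv.lTensor A ((Mult.tmul 1 (Mult.of K z') *
        (J⁻¹ : (Mult K (A ⊗[K] A))ˣ).val).left v) =
      contractSnd S (X.left (TensorProduct.assoc K A A A (v ⊗ₜ z))) := by
    intro v z z' hz
    rw [Mult.left_mul, ← h1 _ z z' hz, ← hS.contractSnd_extension hI hJ.counit hY,
      ← Mult.left_mul, ← hXY, Mult.left_mul, left_leg12_assoc, ← Mult.left_mul J.val,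
      Units.mul_inv, Mult.left_one]
  have h3 : ∀ z z' b c, b * (P.left (Q.left (z * z')) * S.toLinearEquiv c) =
      b * (z * z' * S.toLinearEquiv c) := by
    intro z z' b c
    -- Here S⁻¹ appears because the third leg is written as a value of S, as in `contractSnd_assoc`.
    let Λ : A ⊗[K] A →ₗ[K] Mult K (A ⊗[K] A) := TensorProduct.lift (LinearMap.mk₂ K
      (fun p r => Mult.tmul 1 (Mult.of K (S.toLinearEquiv.symm (r * z'))) * H.Δ p)
      (by simp [mul_add]) (by simp) (by simp [add_mul])
      (by simp [smul_mul_assoc]))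
    have hΛ : ∀ p r, Λ (p ⊗ₜ r) =
      Mult.tmul 1 (Mult.of K (S.toLinearEquiv.symm (r * z'))) * H.Δ p := fun p r => rfl
    have e1 : ∀ w v, contractSnd S ((H.comulLeft w).left
        (TensorProduct.assoc K A A A (v ⊗ₜ z'))) = S.toLinearEquiv.lTensor A ((Λ w).left v) := by
      intro w v
      induction w with
      | zero => simp
      | add x y hx hy => simp only [map_add, Mult.left_add, hx, hy]
      | tmul p r =>
        rw [left_comulLeft_tmul, hΛ, Mult.left_mul, ← contractSnd_assoc,
          LinearEquiv.apply_symm_apply]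
    have e2 : Mult.tmul 1 (Mult.of K (S.toLinearEquiv.symm (Q.left (z * z')))) *
        (J⁻¹ : (Mult K (A ⊗[K] A))ˣ).val * H.Δ q = Λ (J.val.left (q ⊗ₜ z)) := by
      refine (nondegenerateMul_tensor hA).mult_ext_left fun v => ?_
      apply (S.toLinearEquiv.lTensor A).injective
      rw [Mult.left_mul, h2 _ (z * z') _ (by simp), ← left_comulLeft_tmul,
        left_of_isExtension hX, e1]
    have e3 : ∀ w, S.contractRight ((Λ w).right (b ⊗ₜ c)) =
        b * (counitLeft ε w * z' * S.toLinearEquiv c) := by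
      intro w
      induction w with
      | zero => simp
      | add x y hx hy => simp only [map_add, add_mul, mul_add, Mult.right_add, hx, hy]
      | tmul p r =>
        rw [hΛ, Mult.right_mul, hS.contractRight_right hI]
        simp [counitLeft, smul_mul_assoc, mul_smul_comm, S.map_mul]
    have e4 := congrArg (fun m => S.contractRight (m.right (b ⊗ₜ c))) e2
    simp only [e3, Mult.right_mul, hS.contractRight_right hI, Mult.right_tmul, Mult.right_of,
      Mult.right_one, ← hP, hJ.counit.counitLeft_left hA, hq, one_smul, S.map_mul,
      LinearEquiv.apply_symm_apply, Mult.left_mul_apply _ (Q.left _)] at e4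
    rw [e4]
    simp [counitLeft, hq]
  refine hA.mult_ext_left fun z => hA.right_cancel fun c => hA.left_cancel fun b => ?_
  obtain ⟨c, rfl⟩ := S.toLinearEquiv.surjective c
  induction z using hI.induction with
  | hmul z z' => exact h3 z z' b c
  | hadd x y hx hy => simp only [map_add, add_mul, mul_add, hx, hy]

end RegularMultiplierHopfAlgebra

end Twist

/-! ### From Drinfeld's element to S⁴, and the intertwining property of R^J. -/

section Main

variable {K A : Type*} [Field K]
  [NonUnitalRing A] [Module K A] [IsScalarTower K A A] [SMulCommClass K A A]

theorem AntiAut.extend_of (S : AntiAut K A) (a : A) :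
    S.extend (Mult.of K a) = Mult.of K (S.toLinearEquiv a) := by
  ext b <;> simp [extend, S.map_mul]

theorem AntiAut.extend_mul (S : AntiAut K A) (m n : Mult K A) :
    S.extend (m * n) = S.extend n * S.extend m := by
  ext b <;> simp [extend]

/-- If `u` implements `S²`, then `u S(u)⁻¹` implements `S⁴`. -/
theorem AntiAut.iterate_four_eq_conj (S : AntiAut K A) (u : (Mult K A)ˣ)
    (hu : ∀ c, u.val * Mult.of K c = Mult.of K (S.toLinearEquiv (S.toLinearEquiv c)) * u.val)
    (a : A) : Mult.of K (S.toLinearEquiv^[4] a) =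
      (u * (S.extendUnits u)⁻¹).val * Mult.of K a * ((u * (S.extendUnits u)⁻¹)⁻¹ :).val := by
  -- Apply S to u c = S²(c) u with c = S⁻¹(a).
  have h1 : ∀ a, Mult.of K a * (S.extendUnits u).val =
      (S.extendUnits u).val * Mult.of K (S.toLinearEquiv (S.toLinearEquiv a)) := by
    intro a
    have := congrArg S.extend (hu (S.toLinearEquiv.symm a))
    rw [S.extend_mul, S.extend_mul, S.extend_of, S.extend_of, LinearEquiv.apply_symm_apply] at this
    exact this
  rw [mul_inv_rev, inv_inv, Units.val_mul, Units.val_mul, mul_assoc, mul_assoc,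
    ← mul_assoc (Mult.of K a), h1]
  simp only [← mul_assoc]
  rw [Units.inv_mul_cancel_right, hu, Units.mul_inv_cancel_right]
  rfl

theorem twistedR_mul_eq_one (R J : (Mult K (A ⊗[K] A))ˣ) :
    twistedR R J * ((J⁻¹ :).val * (R⁻¹ :).val * J.val.flip) = 1 := by
  have h : (J⁻¹ :).val.flip * J.val.flip = 1 := by
    rw [← Mult.flip_mul, Units.inv_mul, Mult.flip_one]
  simp only [twistedR, ← mul_assoc]
  rw [Units.mul_inv_cancel_right, Units.mul_inv_cancel_right, h]

theorem mul_twistedR_eq_one (R J : (Mult K (A ⊗[K] A))ˣ) :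
    (J⁻¹ :).val * (R⁻¹ :).val * J.val.flip * twistedR R J = 1 := by
  have h : J.val.flip * (J⁻¹ :).val.flip = 1 := by
    rw [← Mult.flip_mul, Units.mul_inv, Mult.flip_one]
  simp only [twistedR, mul_assoc]
  rw [← mul_assoc J.val.flip, h, one_mul, Units.inv_mul_cancel_left, Units.inv_mul]

theorem twistedR_mul_comul {R J : (Mult K (A ⊗[K] A))ˣ} {D : Mult K (A ⊗[K] A)}
    (h : R.val * D = D.flip * R.val) :
    twistedR R J * ((J⁻¹ :).val * D * J.val) =
      ((J⁻¹ :).val * D * J.val).flip * twistedR R J := by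
  have hJ : J.val.flip * (J⁻¹ :).val.flip = 1 := by
    rw [← Mult.flip_mul, Units.mul_inv, Mult.flip_one]
  simp only [twistedR, Mult.flip_mul, mul_assoc]
  rw [Units.mul_inv_cancel_left, ← mul_assoc J.val.flip, hJ, one_mul, ← mul_assoc R.val, h,
    mul_assoc]

end Main

end

theorem proposition2p7 {K A : Type*} [Field K]
    [NonUnitalRing A] [Module K A] [IsScalarTower K A A] [SMulCommClass K A A]
    (H : RegularMultiplierHopfAlgebra K A)
    (ε : A →ₙₐ[K] K) (hε : H.IsCounit ε) (S : AntiAut K A) (hS : H.IsAntipode ε S)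
    (R : (Mult K (A ⊗[K] A))ˣ) (hR : H.IsQuasitriangular ε R)
    (J : (Mult K (A ⊗[K] A))ˣ) (hJ : H.IsTwist ε J)
    (hJc : IsCovered J.val) (hJc' : IsCovered (J⁻¹ : (Mult K (A ⊗[K] A))ˣ).val) :
    ∃ Q : (Mult K A)ˣ, IsAntipodeFst S J.val Q.val ∧
      ∃ SJ : AntiAut K A, SJ = S.conj H.nondegenerate Q ∧
      ∃ μ : (Mult K A)ˣ, IsAntipodeSnd SJ (twistedR R J) μ.val ∧
      ∃ g : (Mult K A)ˣ, g = μ * (SJ.extendUnits μ)⁻¹ ∧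
      ∀ a : A, Mult.of K (SJ.toLinearEquiv^[4] a) =
        g.val * Mult.of K a * (g⁻¹ : (Mult K A)ˣ).val := by
  have hI := hε.isIdempotentAlg
  obtain ⟨Q, hQ⟩ := hJc.exists_contractLeft H.nondegenerate hI S
  obtain ⟨P, hP⟩ := hJc'.exists_contractRight H.nondegenerate hI S
  let Qu : (Mult K A)ˣ := ⟨Q, P, hJ.contractLeft_mul_contractRight hε hS hQ hP,
    hJ.contractRight_mul_contractLeft hε hS hQ hP⟩
  obtain ⟨μ, hμ, hμc⟩ := (hS.isAntipodeFor_conj hI J Qu hQ).exists_unit_drinfeld H.nondegenerate hI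
    (twistedR_mul_eq_one R J) (mul_twistedR_eq_one R J) (fun a => twistedR_mul_comul (hR.comm a))
  exact ⟨Qu, hQ, _, rfl, μ, hμ, _, rfl, AntiAut.iterate_four_eq_conj _ μ hμc⟩
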